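/- Let $0<a<\infty$, $I=(-a,a)$, $k\in\mathbb{R}\setminus\{0,-1\}$, and let $A=k$ on $(-a,0)$ and $A=1$ on $(0,a)$. For $n\ge 1$ put $\lambda_n=\frac{(2n-1)\pi}{2a}$, $\mu_n=\frac{n\pi}{a}$, $f_n(x)=\cos(\lambda_n x)$, and $g_n(x)=\sin(\mu_n x)$ for $x<0$, $g_n(x)=k\sin(\mu_n x)$ for $x\ge 0$. Let $u_0\in L^2(I)$ (real valued) and $$a_n=\frac{\int_I A\,u_0 f_n\,dx}{\int_I A|f_n|^2\,dx},\qquad b_n=\frac{\int_I A\,u_0 g_n\,dx}{\int_I A|g_n|^2\,dx}.$$ A weak solution of $$A\,\partial_t u=\tfrac12\,\partial_x(A\,\partial_x u)\ \text{ in } (0,\infty)\times I,\qquad u(t,\pm a)=0,\qquad u(0,\cdot)=u_0,$$ is a function $u:[0,\infty)\to L^2(I)$ such that $u\in L^2(0,\infty;H^1_0(I))$; $A\,\partial_t u\in L^2(0,\infty;H^{-1}(I))$, where $A\,\partial_t u$ is the weak time derivative of $Au$ and $Au(t)$ is regarded as the functional $v\mapsto\int_I A\,u(t)\,v\,dx$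 on $H^1_0(I)$; for a.e. $t>0$, $$2\,\langle A\,\partial_t u(t),v\rangle+\int_I A\,\partial_x u(t)\,\partial_x v\,dx=0\qquad\text{for all } v\in H^1_0(I);$$ and $u(0)=u_0$, where $u$ is the representative for which $t\mapsto\int_I A\,u(t)\,v\,dx$ is continuous on $[0,\infty)$ for every $v\in H^1_0(I)$. Then: 1. For every $t\ge 0$ the series $$u(t,\cdot)=\sum_{n\ge1}\left(a_n e^{-\lambda_n^2t/2}f_n+b_n e^{-\mu_n^2t/2}g_n\right)$$ converges in $L^2(I)$ (unconditionally). The function $u$ is continuous from $[0,\infty)$ to $L^2(I)$, it is a weak solution, and it is the only one. 2. For all $t>0$ and $x,y\in I$ the series $$\bar p(t,x,y)=\sum_{n\ge1}A(y)\left(\frac{2}{a(k+1)}f_n(y)f_n(x)e^{-\lambda_n^2t/2}+\frac{2}{ak(k+1)}g_n(y)g_n(x)e^{-\mu_n^2t/2}\right)$$ converges absolutely (here $A(0)=1$, say). For all $t>0$ and $x\in I$, the function $u_0\,\bar p(t,x,\cdot)$ is integrable on $I$, the series of $u$ converges at the point $x$, and its sum is $$u(t,x)=\int_I u_0(y)\,\bar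 p(t,x,y)\,dy .$$ -/

import Mathlib

open MeasureTheory Set Filter Topology
open scoped ContDiff ENNReal

noncomputable section

namespace SignChanging

/-- Lebesgue measure on the interval `I = (-a, a)`. -/
abbrev muI (a : ℝ) : Measure ℝ := volume.restrict (Ioo (-a) a)

/-- The space `L²(I)` (real valued). -/
abbrev L2I (a : ℝ) : Type := Lp ℝ 2 (muI a)

/-- The conductivity: `k` on `(-a, 0)` and `1` on `(0, a)`. -/
def A (k x : ℝ) : ℝ := if x < 0 then k else 1

/-- `λ_n = (2n - 1)π / (2a)`, used for `n ≥ 1`. -/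
def lam (a : ℝ) (n : ℕ) : ℝ := (2 * (n : ℝ) - 1) * Real.pi / (2 * a)

/-- `μ_n = nπ / a`, used for `n ≥ 1`. -/
def mu (a : ℝ) (n : ℕ) : ℝ := (n : ℝ) * Real.pi / a

/-- `f_n(x) = cos(λ_n x)`. -/
def f (a : ℝ) (n : ℕ) (x : ℝ) : ℝ := Real.cos (lam a n * x)

/-- `g_n(x) = sin(μ_n x)` for `x < 0` and `k sin(μ_n x)` for `x ≥ 0`. -/
def g (a k : ℝ) (n : ℕ) (x : ℝ) : ℝ :=
  if x < 0 then Real.sin (mu a n * x) else k * Real.sin (mu a n * x)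

theorem memLp_f (a : ℝ) (n : ℕ) : MemLp (f a n) 2 (muI a) := by
  refine MemLp.of_bound (C := 1) ?_ (Eventually.of_forall fun x => ?_)
  · have h : Continuous (f a n) := by unfold f; fun_prop
    exact h.aestronglyMeasurable
  · simpa [f] using Real.abs_cos_le_one (lam a n * x)

theorem memLp_g (a k : ℝ) (n : ℕ) : MemLp (g a k n) 2 (muI a) := by
  refine MemLp.of_bound (C := 1 + |k|) ?_ (Eventually.of_forall fun x => ?_)
  · have h : Measurable (g a k n) := by
      unfold g
      exact Measurable.ite measurableSet_Iio (by fun_prop) (by fun_prop)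
    exact h.aestronglyMeasurable
  · have h1 := Real.abs_sin_le_one (mu a n * x)
    have h2 := abs_nonneg k
    unfold g
    split_ifs
    · rw [Real.norm_eq_abs]; linarith
    · rw [Real.norm_eq_abs, abs_mul]
      nlinarith [abs_nonneg (Real.sin (mu a n * x))]

/-- `f_n` as an element of `L²(I)`. -/
def fL (a : ℝ) (n : ℕ) : L2I a := (memLp_f a n).toLp (f a n)

/-- `g_n` as an element of `L²(I)`. -/
def gL (a k : ℝ) (n : ℕ) : L2I a := (memLp_g a k n).toLp (g a k n)

/-- `a_n = ∫_I A u₀ f_n / ∫_I A |f_n|²`. -/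
def coeffA (a k : ℝ) (u₀ : L2I a) (n : ℕ) : ℝ :=
  (∫ x in Ioo (-a) a, A k x * u₀ x * f a n x) / ∫ x in Ioo (-a) a, A k x * |f a n x| ^ 2

/-- `b_n = ∫_I A u₀ g_n / ∫_I A |g_n|²`. -/
def coeffB (a k : ℝ) (u₀ : L2I a) (n : ℕ) : ℝ :=
  (∫ x in Ioo (-a) a, A k x * u₀ x * g a k n x) / ∫ x in Ioo (-a) a, A k x * |g a k n x| ^ 2

/-- The `n`-th term of the series, `a_n e^{-λ_n² t/2} f_n + b_n e^{-μ_n² t/2} g_n`, in `L²(I)`. -/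
def termL (a k : ℝ) (u₀ : L2I a) (t : ℝ) (n : ℕ) : L2I a :=
  (coeffA a k u₀ n * Real.exp (-(lam a n) ^ 2 * t / 2)) • fL a n +
    (coeffB a k u₀ n * Real.exp (-(mu a n) ^ 2 * t / 2)) • gL a k n

/-- The value at the point `x` of the `n`-th term of the series. -/
def termPt (a k : ℝ) (u₀ : L2I a) (t x : ℝ) (n : ℕ) : ℝ :=
  coeffA a k u₀ n * Real.exp (-(lam a n) ^ 2 * t / 2) * f a n x +
    coeffB a k u₀ n * Real.exp (-(mu a n) ^ 2 * t / 2) * g a k n x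

/-- `u(t, ·) = P_t u₀`, the sum over `n ≥ 1` of the series, in `L²(I)`. -/
def spectralSol (a k : ℝ) (u₀ : L2I a) (t : ℝ) : L2I a :=
  ∑' n : ℕ, termL a k u₀ t (n + 1)

/-- The `n`-th term of the spectral kernel. -/
def kernelTerm (a k t x y : ℝ) (n : ℕ) : ℝ :=
  A k y *
    (2 / (a * (k + 1)) * f a n y * f a n x * Real.exp (-(lam a n) ^ 2 * t / 2) +
      2 / (a * k * (k + 1)) * g a k n y * g a k n x * Real.exp (-(mu a n) ^ 2 * t / 2))

/-- The spectral kernel `p̄(t, x, y)`, a sum over `n ≥ 1`. -/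
def pbar (a k t x y : ℝ) : ℝ := ∑' n : ℕ, kernelTerm a k t x y (n + 1)

/-- Test functions: smooth, with compact support contained in `s`. -/
def IsTest (s : Set ℝ) (φ : ℝ → ℝ) : Prop :=
  ContDiff ℝ ∞ φ ∧ HasCompactSupport φ ∧ tsupport φ ⊆ s

/-- The space `H¹₀(I)`: the closure of the test functions on `I` for the norm
`(‖u‖² + ‖u'‖²)^{1/2}`. An element is stored as the pair `(u, u')` in `L²(I) × L²(I)`, where `u'` is
the weak derivative of `u`. -/
def H10 (a : ℝ) : Submodule ℝ (WithLp 2 (L2I a × L2I a)) :=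
  (Submodule.span ℝ {p : WithLp 2 (L2I a × L2I a) |
    ∃ φ : ℝ → ℝ, IsTest (Ioo (-a) a) φ ∧
      p.fst =ᵐ[muI a] φ ∧ p.snd =ᵐ[muI a] deriv φ}).topologicalClosure

/-- The function underlying an element of `H¹₀(I)`. -/
def fn {a : ℝ} (v : H10 a) : L2I a := (v : WithLp 2 (L2I a × L2I a)).fst

/-- The weak derivative of an element of `H¹₀(I)`. -/
def dx {a : ℝ} (v : H10 a) : L2I a := (v : WithLp 2 (L2I a × L2I a)).snd

/-- The dual space `H⁻¹(I)` of `H¹₀(I)`, with its operator norm. -/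
abbrev Hm1 (a : ℝ) : Type := H10 a →L[ℝ] ℝ

/-- `u : [0, ∞) → L²(I)` is a weak solution, with initial value `u₀`, of
`A ∂_t u = ½ ∂_x (A ∂_x u)` in `I`, `u(t, ±a) = 0`:

* `u` belongs to `L²(0, ∞; H¹₀(I))` (witness `U`);
* `A ∂_t u` belongs to `L²(0, ∞; H⁻¹(I))`: `W` is the weak derivative in time of `A u`, the function
  `A u(t)` being regarded as the functional `v ↦ ∫_I A u(t) v`;
* for a.e. `t > 0` and all `v` in `H¹₀(I)`, `2 ⟨A ∂_t u(t), v⟩ + ∫_I A ∂_x u(t) ∂_x v = 0`;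
* `u(0) = u₀`, where `u` is the representative for which `t ↦ ∫_I A u(t) v` is continuous on
  `[0, ∞)` for all `v` in `H¹₀(I)`. -/
def IsWeakSolution (a k : ℝ) (u₀ : L2I a) (u : ℝ → L2I a) : Prop :=
  (∃ (U : ℝ → H10 a) (W : ℝ → Hm1 a),
    MemLp U 2 (volume.restrict (Ioi 0)) ∧
    (∀ᵐ t ∂(volume.restrict (Ioi (0 : ℝ))), fn (U t) = u t) ∧
    MemLp W 2 (volume.restrict (Ioi 0)) ∧
    (∀ (v : H10 a) (φ : ℝ → ℝ), IsTest (Ioi 0) φ →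
      ∫ t in Ioi (0 : ℝ), deriv φ t * (∫ x in Ioo (-a) a, A k x * u t x * fn v x) =
        -∫ t in Ioi (0 : ℝ), φ t * W t v) ∧
    (∀ᵐ t ∂(volume.restrict (Ioi (0 : ℝ))), ∀ v : H10 a,
      2 * W t v + ∫ x in Ioo (-a) a, A k x * dx (U t) x * dx v x = 0)) ∧
  (∀ v : H10 a, ContinuousOn (fun t => ∫ x in Ioo (-a) a, A k x * u t x * fn v x) (Ici 0)) ∧
  u 0 = u₀

end SignChanging

end

open SignChanging

/-! For `k < 0` the form `∫ A u v` is indefinite, so it provides neither a Hilbert structure nor an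
energy estimate. The explicit eigenfunctions replace both: `f_n` is `cos (λ_n x)`, and `g_n` is `sin
(μ_n x)` times `1 + k - A`, a multiplier that exchanges the two values of `A`. These cosines and
sines together are orthogonal in `L²(I)`, and so are their derivatives. The eigenfunctions are
therefore images of an orthogonal family under two bounded operators, which gives an upper Riesz
bound in `L²(I)` and, with weight `1 + ν²` at frequency `ν`, in `H¹₀(I)` (`exists_besselBound_eigL`,
`exists_besselBound_eigH`). Convergence, continuity in time and the bound in `L²(0, ∞; H¹₀)` all
follow from these bounds and square summable coefficients.

Since `A (1 + k - A) = k` and the even part of `A` is `(k + 1) / 2`, the eigenfunctions are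
orthogonal for the form, with nonzero squares because `k ≠ 0, -1` (`integral_A_eig_mul_eig`). They
are complete (`eq_zero_of_inner_A_eigL_eq_zero`): a function orthogonal to every `g_n` is even, and
for an even function orthogonality to `f_n` means orthogonality to `cos (λ_n x)`, which a
half-integer shift of frequencies reduces to the Fourier basis.

The flux `A e'` of an eigenfunction `e` is continuous at `0`, so the eigenvalue equation holds
weakly (`inner_A_eigDerivL`). Hence the pairing `m` of any weak solution with `e` solves `m' =
-(ν²/2) m`; with completeness this gives uniqueness. The kernel series is dominated by a geometric
series uniformly in `x, y`, so it may be integrated term by term. -/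

noncomputable section

namespace SignChanging

/-! ### Weighted upper Riesz bounds. -/

section BesselBound

variable {ι E : Type*} [NormedAddCommGroup E] [NormedSpace ℝ E]

/-- The weighted upper Riesz bound `‖∑ c_i x_i‖² ≤ K ∑ w_i c_i²` for finite sums. -/
def BesselBound (x : ι → E) (w : ι → ℝ) (K : ℝ) : Prop :=
  0 ≤ K ∧ (∀ i, 0 ≤ w i) ∧
    ∀ (s : Finset ι) (c : ι → ℝ), ‖∑ i ∈ s, c i • x i‖ ^ 2 ≤ K * ∑ i ∈ s, w i * c i ^ 2

theorem BesselBound.summable [CompleteSpace E] {x : ι → E} {w : ι → ℝ} {K : ℝ}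
    (h : BesselBound x w K) {c : ι → ℝ} (hc : Summable fun i => w i * c i ^ 2) :
    Summable fun i => c i • x i := by
  obtain ⟨hK, hw, h⟩ := h
  rw [summable_iff_vanishing_norm] at hc ⊢
  intro ε hε
  -- Cauchy criterion; `K + 1` instead of `K` keeps the divisor positive when `K = 0`.
  obtain ⟨s, hs⟩ := hc (ε ^ 2 / (K + 1)) (by positivity)
  refine ⟨s, fun t ht => ?_⟩
  have h1 := hs t ht
  rw [Real.norm_of_nonneg (Finset.sum_nonneg fun i _ => mul_nonneg (hw i) (sq_nonneg _)),
    lt_div_iff₀ (by positivity)] at h1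
  have h2 := h t c
  have h3 : 0 ≤ ∑ i ∈ t, w i * c i ^ 2 :=
    Finset.sum_nonneg fun i _ => mul_nonneg (hw i) (sq_nonneg _)
  exact lt_of_pow_lt_pow_left₀ 2 hε.le (by nlinarith)

theorem BesselBound.norm_tsum_sq_le [CompleteSpace E] {x : ι → E} {w : ι → ℝ} {K : ℝ}
    (h : BesselBound x w K) {c : ι → ℝ} (hc : Summable fun i => w i * c i ^ 2) :
    ‖∑' i, c i • x i‖ ^ 2 ≤ K * ∑' i, w i * c i ^ 2 := by
  have h1 := ((h.summable hc).hasSum.norm.pow 2)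
  have h2 := (hc.hasSum.mul_left K)
  refine le_of_tendsto_of_tendsto h1 h2 (Eventually.of_forall fun s => ?_)
  simpa [Finset.mul_sum] using h.2.2 s c

/-- Duality: with `c i = ⟨x i, u⟩` the partial sum `S` of squares equals `⟨∑ c i • x i, u⟩`, so `S²
≤ K S ‖u‖²`, and one factor `S` cancels. -/
theorem BesselBound.summable_inner_sq {H : Type*} [NormedAddCommGroup H] [InnerProductSpace ℝ H]
    {x : ι → H} {K : ℝ} (h : BesselBound x (fun _ => 1) K) (u : H) :
    Summable fun i => inner ℝ (x i) u ^ 2 := by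
  refine summable_of_sum_le (c := K * ‖u‖ ^ 2) (fun i => sq_nonneg _) fun s => ?_
  have h1 := h.2.2 s fun i => inner ℝ (x i) u
  simp only [one_mul] at h1
  set S : ℝ := ∑ i ∈ s, inner ℝ (x i) u ^ 2
  have hS : S = inner ℝ (∑ i ∈ s, inner ℝ (x i) u • x i) u := by
    rw [sum_inner]
    refine Finset.sum_congr rfl fun i _ => ?_
    rw [inner_smul_left, conj_trivial, sq]
  have hS0 : 0 ≤ S := Finset.sum_nonneg fun i _ => sq_nonneg _
  have h2 : S ≤ ‖∑ i ∈ s, inner ℝ (x i) u • x i‖ * ‖u‖ := hS ▸ real_inner_le_norm _ _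
  have h3 : S * S ≤ K * S * ‖u‖ ^ 2 := by
    calc S * S ≤ (‖∑ i ∈ s, inner ℝ (x i) u • x i‖ * ‖u‖) *
            (‖∑ i ∈ s, inner ℝ (x i) u • x i‖ * ‖u‖) :=
          mul_le_mul h2 h2 hS0 (hS0.trans h2)
      _ = ‖∑ i ∈ s, inner ℝ (x i) u • x i‖ ^ 2 * ‖u‖ ^ 2 := by ring
      _ ≤ _ := by gcongr
  rcases hS0.eq_or_lt with h0 | h0
  · rw [← h0]; have := h.1; positivity
  · nlinarith

/-- Only two operators occur, so the sum splits into two images of orthogonal sums. The factor `ν i`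
serves derivatives of eigenfunctions, and `r` undoes the normalisation of the orthonormal family. -/
theorem besselBound_of_orthonormal {H F : Type*} [NormedAddCommGroup H] [InnerProductSpace ℝ H]
    [NormedAddCommGroup F] [NormedSpace ℝ F] {o : ι → H} (ho : Orthonormal ℝ o) (b : ι → Bool)
    (M : Bool → H →L[ℝ] F) (r : ℝ) (ν : ι → ℝ) :
    BesselBound (fun i => (r * ν i) • M (b i) (o i)) (fun i => ν i ^ 2)
      (r ^ 2 * (‖M true‖ + ‖M false‖) ^ 2) := by
  refine ⟨by positivity, fun i => sq_nonneg _, fun s c => ?_⟩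
  set S : ℝ := ∑ i ∈ s, ν i ^ 2 * c i ^ 2 with hS
  have hS0 : 0 ≤ S := Finset.sum_nonneg fun i _ => by positivity
  have key : ∀ β : Bool, ‖∑ i ∈ s with b i = β, c i • (r * ν i) • M (b i) (o i)‖ ≤
      ‖M β‖ * (|r| * √S) := by
    intro β
    have e1 : ∑ i ∈ s with b i = β, c i • (r * ν i) • M (b i) (o i) =
        M β (r • ∑ i ∈ s with b i = β, (ν i * c i) • o i) := by
      rw [map_smul, map_sum, Finset.smul_sum]
      refine Finset.sum_congr rfl fun i hi => ?_
      rw [(Finset.mem_filter.1 hi).2, map_smul, smul_smul, smul_smul]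
      congr 1; ring
    rw [e1]
    refine (ContinuousLinearMap.le_opNorm _ _).trans ?_
    gcongr
    rw [norm_smul, Real.norm_eq_abs]
    gcongr
    refine Real.le_sqrt_of_sq_le ?_
    rw [← real_inner_self_eq_norm_sq, ho.inner_sum]
    refine le_trans (le_of_eq ?_) (Finset.sum_le_sum_of_subset_of_nonneg
      (Finset.filter_subset (fun i => b i = β) s) fun i _ _ => by positivity)
    refine Finset.sum_congr rfl fun i _ => ?_
    simp; ring
  have hsplit : ∑ i ∈ s, c i • (r * ν i) • M (b i) (o i) =
      ∑ i ∈ s with b i = true, c i • (r * ν i) • M (b i) (o i) +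
      ∑ i ∈ s with b i = false, c i • (r * ν i) • M (b i) (o i) := by
    rw [← Finset.sum_filter_add_sum_filter_not s (fun i => b i = true)]
    simp
  have h1 : ‖∑ i ∈ s, c i • (r * ν i) • M (b i) (o i)‖ ≤ (‖M true‖ + ‖M false‖) * (|r| * √S) := by
    rw [hsplit, add_mul]
    exact (norm_add_le _ _).trans (add_le_add (key _) (key _))
  calc _ ≤ ((‖M true‖ + ‖M false‖) * (|r| * √S)) ^ 2 := by gcongr
    _ = _ := by rw [mul_pow, mul_pow, Real.sq_sqrt hS0, sq_abs]; ring

end BesselBound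

/-! ### Series with heat-type exponential factors. -/

section HeatSeries

variable {ι E : Type*} [NormedAddCommGroup E] [NormedSpace ℝ E] [CompleteSpace E]

theorem exp_neg_sq_mul_le_one (ν : ℝ) {t : ℝ} (ht : 0 ≤ t) : Real.exp (-ν ^ 2 * t / 2) ≤ 1 := by
  rw [Real.exp_le_one_iff]
  have := mul_nonneg (sq_nonneg ν) ht
  linarith

theorem sq_exp_neg_sq_mul (ν t : ℝ) : Real.exp (-ν ^ 2 * t / 2) ^ 2 = Real.exp (-ν ^ 2 * t) := by
  rw [← Real.exp_nat_mul]; congr 1; push_cast; ring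

theorem sq_mul_exp_neg_le (ν : ℝ) {t : ℝ} (ht : 0 < t) : ν ^ 2 * Real.exp (-ν ^ 2 * t) ≤ 1 / t := by
  have h := Real.add_one_le_exp (ν ^ 2 * t)
  have h2 : Real.exp (-ν ^ 2 * t) * Real.exp (ν ^ 2 * t) = 1 := by
    rw [← Real.exp_add]; simp
  have h3 := Real.exp_pos (-ν ^ 2 * t)
  rw [le_div_iff₀ ht]
  nlinarith

theorem summable_heat_sq {c ν : ι → ℝ} (hc : Summable fun i => c i ^ 2) {t : ℝ} (ht : 0 ≤ t) :
    Summable fun i => (1 : ℝ) * (c i * Real.exp (-(ν i) ^ 2 * t / 2)) ^ 2 := by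
  refine Summable.of_nonneg_of_le (fun i => by positivity) (fun i => ?_) hc
  have h1 := exp_neg_sq_mul_le_one (ν i) ht
  have h0 := (Real.exp_pos (-(ν i) ^ 2 * t / 2)).le
  rw [one_mul, mul_pow]
  exact mul_le_of_le_one_right (sq_nonneg _) (pow_le_one₀ h0 h1)

/-- Smoothing: for `t > 0` the exponential absorbs the `H¹` weight, at the cost of the factor `1 + 1
/ t`. -/
theorem summable_heat_weight_sq {c ν : ι → ℝ} (hc : Summable fun i => c i ^ 2) {t : ℝ}
    (ht : 0 < t) :
    Summable fun i => (1 + ν i ^ 2) * (c i * Real.exp (-(ν i) ^ 2 * t / 2)) ^ 2 := by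
  refine Summable.of_nonneg_of_le (fun i => by positivity) (fun i => ?_) (hc.mul_left (1 + 1 / t))
  have h1 := sq_mul_exp_neg_le (ν i) ht
  have h2 : Real.exp (-(ν i) ^ 2 * t) ≤ 1 := by
    rw [Real.exp_le_one_iff]
    have := mul_nonneg (sq_nonneg (ν i)) ht.le
    linarith
  rw [mul_pow, sq_exp_neg_sq_mul]
  have h3 := sq_nonneg (c i)
  nlinarith

/-- The Riesz bound reduces the claim to the sum of squared coefficient differences, which tends to
`0` by dominated convergence with majorant `c i ^ 2`. This includes the endpoint `0`. -/
theorem continuousOn_heat_series {x : ι → E} {K : ℝ} (hx : BesselBound x (fun _ => 1) K)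
    {c ν : ι → ℝ} (hc : Summable fun i => c i ^ 2) :
    ContinuousOn (fun t => ∑' i, (c i * Real.exp (-(ν i) ^ 2 * t / 2)) • x i) (Ici (0 : ℝ)) := by
  intro s hs
  have hs : (0 : ℝ) ≤ s := hs
  rw [ContinuousWithinAt, tendsto_iff_norm_sub_tendsto_zero]
  have hlim : Tendsto (fun t => ∑' i, (c i * Real.exp (-(ν i) ^ 2 * t / 2) -
      c i * Real.exp (-(ν i) ^ 2 * s / 2)) ^ 2) (𝓝[Ici 0] s) (𝓝 (∑' _ : ι, (0 : ℝ))) := by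
    refine tendsto_tsum_of_dominated_convergence hc (fun i => ?_) ?_
    · have : Continuous fun t => (c i * Real.exp (-(ν i) ^ 2 * t / 2) -
        c i * Real.exp (-(ν i) ^ 2 * s / 2)) ^ 2 := by fun_prop
      have h := (this.tendsto s).mono_left (nhdsWithin_le_nhds (s := Ici (0 : ℝ)))
      simpa using h
    · filter_upwards [self_mem_nhdsWithin] with t ht i
      have ht : (0 : ℝ) ≤ t := ht
      rw [Real.norm_of_nonneg (sq_nonneg _), ← mul_sub, mul_pow]
      refine mul_le_of_le_one_right (sq_nonneg _) ?_
      rw [sq_le_one_iff_abs_le_one, abs_le]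
      have h1 := exp_neg_sq_mul_le_one (ν i) ht
      have h2 := exp_neg_sq_mul_le_one (ν i) hs
      have h3 := Real.exp_pos (-(ν i) ^ 2 * t / 2)
      have h4 := Real.exp_pos (-(ν i) ^ 2 * s / 2)
      constructor <;> linarith
  rw [tsum_zero] at hlim
  have hlim2 := (hlim.const_mul K).sqrt
  rw [mul_zero, Real.sqrt_zero] at hlim2
  refine squeeze_zero' (Eventually.of_forall fun _ => norm_nonneg _) ?_ hlim2
  filter_upwards [self_mem_nhdsWithin] with t ht
  have ht : (0 : ℝ) ≤ t := ht
  have e1 := hx.summable (summable_heat_sq (ν := ν) hc ht)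
  have e2 := hx.summable (summable_heat_sq (ν := ν) hc hs)
  have hd : Summable fun i => (1 : ℝ) * (c i * Real.exp (-(ν i) ^ 2 * t / 2) -
      c i * Real.exp (-(ν i) ^ 2 * s / 2)) ^ 2 := by
    refine Summable.of_nonneg_of_le (fun i => by positivity) (fun i => ?_)
      (((summable_heat_sq (ν := ν) hc ht).mul_left 2).add
        ((summable_heat_sq (ν := ν) hc hs).mul_left 2))
    nlinarith [sq_nonneg (c i * Real.exp (-(ν i) ^ 2 * t / 2) +
      c i * Real.exp (-(ν i) ^ 2 * s / 2))]
  have h := hx.norm_tsum_sq_le hd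
  simp only [one_mul, sub_smul] at h
  rw [e1.tsum_sub e2] at h
  exact Real.le_sqrt_of_sq_le h

/-- The pointwise bound `1 + 1 / t` is not integrable at `0`, so the squared norm is integrated term
by term: each exponential contributes `1 / ν²`, and the spectral gap `δ` bounds `(1 + ν²) / ν²` by
`1 + 1 / δ`. -/
theorem memLp_heat_series [Countable ι] {x : ι → E} {K δ : ℝ} {c ν : ι → ℝ}
    (hx : BesselBound x (fun i => 1 + ν i ^ 2) K)
    (hc : Summable fun i => c i ^ 2) (hδ : 0 < δ) (hν : ∀ i, δ ≤ ν i ^ 2) :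
    MemLp (fun t => ∑' i, (c i * Real.exp (-(ν i) ^ 2 * t / 2)) • x i) 2
      (volume.restrict (Ioi (0 : ℝ))) := by
  have hsum : ∀ t : ℝ, 0 < t → Summable fun i => (c i * Real.exp (-(ν i) ^ 2 * t / 2)) • x i :=
    fun t ht => hx.summable (summable_heat_weight_sq hc ht)
  have hmeas : AEStronglyMeasurable
      (fun t => ∑' i, (c i * Real.exp (-(ν i) ^ 2 * t / 2)) • x i)
      (volume.restrict (Ioi (0 : ℝ))) := by
    refine aestronglyMeasurable_of_tendsto_ae (atTop : Filter (Finset ι))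
      (f := fun s t => ∑ i ∈ s, (c i * Real.exp (-(ν i) ^ 2 * t / 2)) • x i) (fun s => ?_) ?_
    · refine Continuous.aestronglyMeasurable ?_
      fun_prop
    · filter_upwards [ae_restrict_mem measurableSet_Ioi] with t ht
      exact (hsum t ht).hasSum
  refine ⟨hmeas, ?_⟩
  rw [eLpNorm_lt_top_iff_lintegral_rpow_enorm_lt_top (by norm_num) (by norm_num)]
  have hI : ∀ i, IntegrableOn (fun t => (1 + ν i ^ 2) * c i ^ 2 * Real.exp (-(ν i) ^ 2 * t))
      (Ioi (0 : ℝ)) := fun i =>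
    (integrableOn_exp_mul_Ioi (by have := hν i; linarith) 0).const_mul _
  have hval : ∀ i, ∫ t in Ioi (0 : ℝ), (1 + ν i ^ 2) * c i ^ 2 * Real.exp (-(ν i) ^ 2 * t) =
      (1 + ν i ^ 2) * c i ^ 2 / ν i ^ 2 := by
    intro i
    have h0 : ν i ^ 2 ≠ 0 := (hδ.trans_le (hν i)).ne'
    rw [integral_const_mul, integral_exp_mul_Ioi (by have := hν i; linarith)]
    simp
    field_simp
  have hS : Summable fun i => (1 + ν i ^ 2) * c i ^ 2 / ν i ^ 2 := by
    refine Summable.of_nonneg_of_le (fun i => by positivity) (fun i => ?_)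
      (hc.mul_left (1 + 1 / δ))
    have h0 : 0 < ν i ^ 2 := hδ.trans_le (hν i)
    rw [div_le_iff₀ h0]
    have : 1 ≤ 1 / δ * ν i ^ 2 := by
      rw [one_div, inv_mul_eq_div, one_le_div₀ hδ]; exact hν i
    nlinarith [sq_nonneg (c i)]
  calc ∫⁻ t in Ioi (0 : ℝ),
        ‖∑' i, (c i * Real.exp (-(ν i) ^ 2 * t / 2)) • x i‖ₑ ^ (2 : ℝ≥0∞).toReal
      ≤ ∫⁻ t in Ioi (0 : ℝ), ENNReal.ofReal K *
        ∑' i, ENNReal.ofReal ((1 + ν i ^ 2) * c i ^ 2 * Real.exp (-(ν i) ^ 2 * t)) := by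
        refine setLIntegral_mono_ae' measurableSet_Ioi (Eventually.of_forall fun t ht => ?_)
        have hs := summable_heat_weight_sq (ν := ν) hc ht
        have h := hx.norm_tsum_sq_le hs
        have e : ∀ i, (1 + ν i ^ 2) * (c i * Real.exp (-(ν i) ^ 2 * t / 2)) ^ 2 =
            (1 + ν i ^ 2) * c i ^ 2 * Real.exp (-(ν i) ^ 2 * t) := fun i => by
          rw [mul_pow, sq_exp_neg_sq_mul]; ring
        simp only [e] at h hs
        rw [← ENNReal.ofReal_tsum_of_nonneg (fun i => by positivity) hs,
          ← ENNReal.ofReal_mul hx.1, ENNReal.toReal_ofNat, ← ofReal_norm,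
          ENNReal.ofReal_rpow_of_nonneg (norm_nonneg _) (by norm_num)]
        refine ENNReal.ofReal_le_ofReal ?_
        exact_mod_cast h
    _ = ENNReal.ofReal K * ∑' i, ENNReal.ofReal ((1 + ν i ^ 2) * c i ^ 2 / ν i ^ 2) := by
        rw [lintegral_const_mul' _ _ ENNReal.ofReal_ne_top, lintegral_tsum]
        · congr 2
          ext i
          rw [← hval, ofReal_integral_eq_lintegral_ofReal (hI i)
            (Eventually.of_forall fun t => by positivity)]
        · intro i
          refine Measurable.aemeasurable ?_
          fun_prop
    _ < ⊤ := by
        rw [← ENNReal.ofReal_tsum_of_nonneg (fun i => by positivity) hS]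
        exact ENNReal.mul_lt_top ENNReal.ofReal_lt_top ENNReal.ofReal_lt_top

/-- On `(t / 2, ∞)` the factor `ν² / 2 * exp (-ν² y / 2)` is at most `2 / t`, so the differentiated
series is dominated uniformly by a multiple of `|q i|`. -/
theorem hasDerivAt_heat_series {q ν : ι → ℝ} (hq : Summable q) {t : ℝ} (ht : 0 < t) :
    HasDerivAt (fun t => ∑' i, Real.exp (-(ν i) ^ 2 * t / 2) * q i)
      (∑' i, -(ν i) ^ 2 / 2 * Real.exp (-(ν i) ^ 2 * t / 2) * q i) t := by
  refine hasDerivAt_tsum_of_isPreconnected (t := Ioi (t / 2)) (y₀ := t)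
    (g := fun i t => Real.exp (-(ν i) ^ 2 * t / 2) * q i)
    (g' := fun i t => -(ν i) ^ 2 / 2 * Real.exp (-(ν i) ^ 2 * t / 2) * q i)
    (u := fun i => 2 / t * |q i|) ((hq.abs).mul_left _) isOpen_Ioi isPreconnected_Ioi
    (fun i y _ => ?_) (fun i y hy => ?_) (half_lt_self ht) ?_ (half_lt_self ht)
  · have h : HasDerivAt (fun y => -(ν i) ^ 2 * y / 2) (-(ν i) ^ 2 / 2) y := by
      simpa using ((hasDerivAt_id y).const_mul (-(ν i) ^ 2)).div_const 2
    have := h.exp.mul_const (q i)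
    rwa [mul_comm (Real.exp _) (-(ν i) ^ 2 / 2)] at this
  · have hy : t / 2 < y := hy
    have hy0 : 0 < y / 2 := by linarith
    have h := sq_mul_exp_neg_le (ν i) hy0
    rw [norm_mul, Real.norm_eq_abs (q i)]
    gcongr
    rw [Real.norm_eq_abs, abs_mul, Real.abs_exp]
    have e : |-(ν i) ^ 2 / 2| = ν i ^ 2 / 2 := by
      rw [neg_div, abs_neg, abs_of_nonneg (by positivity)]
    rw [e, show -(ν i) ^ 2 * y / 2 = -(ν i) ^ 2 * (y / 2) by ring]
    have h2 : 1 / (y / 2) ≤ 4 / t := by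
      rw [div_le_div_iff₀ hy0 ht]; linarith
    have h3 : (4 : ℝ) / t = 2 * (2 / t) := by ring
    linarith
  · refine Summable.of_norm_bounded hq.abs fun i => ?_
    rw [norm_mul, Real.norm_eq_abs (q i), Real.norm_of_nonneg (Real.exp_pos _).le]
    exact mul_le_of_le_one_left (abs_nonneg _) (exp_neg_sq_mul_le_one _ ht.le)

end HeatSeries

/-! ### Test functions and weak derivatives in time. -/

section WeakDerivative

theorem IsTest.deriv_continuous {s : Set ℝ} {φ : ℝ → ℝ} (hφ : IsTest s φ) :
    Continuous (deriv φ) :=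
  hφ.1.continuous_deriv (by simp)

theorem IsTest.hasDerivAt {s : Set ℝ} {φ : ℝ → ℝ} (hφ : IsTest s φ) (t : ℝ) :
    HasDerivAt φ (deriv φ t) t :=
  (hφ.1.differentiable (by simp) t).hasDerivAt

theorem IsTest.eq_zero_of_notMem {s : Set ℝ} {φ : ℝ → ℝ} (hφ : IsTest s φ) {t : ℝ} (ht : t ∉ s) :
    φ t = 0 :=
  image_eq_zero_of_notMem_tsupport fun h => ht (hφ.2.2 h)

theorem integrableOn_mul_of_hasCompactSupport {φ m : ℝ → ℝ} (hφ : Continuous φ)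
    (hs : HasCompactSupport φ) (hm : ContinuousOn m (Ici 0)) :
    IntegrableOn (fun t => φ t * m t) (Ioi 0) := by
  obtain ⟨T, hT⟩ := hs.isCompact.bddAbove
  have h1 : IntegrableOn (fun t => φ t * m t) (Icc 0 T) :=
    (hφ.continuousOn.mul (hm.mono Icc_subset_Ici_self)).integrableOn_Icc
  have h2 : IntegrableOn (fun t => φ t * m t) (Ioi T) := by
    refine (integrableOn_zero (ε' := ℝ)).congr_fun (fun t ht => ?_) measurableSet_Ioi
    have : φ t = 0 := image_eq_zero_of_notMem_tsupport fun h => not_lt.2 (hT h) ht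
    simp [this]
  refine (h1.union h2).mono_set fun t ht => ?_
  rcases le_or_gt t T with h | h
  · exact Or.inl ⟨le_of_lt ht, h⟩
  · exact Or.inr h

/-- Fundamental theorem for `φ m` on `[0, ∞)`. Classical differentiability is needed only for `t >
0`: `m` is continuous up to `0`, and `m'` is controlled there in `L²`. -/
theorem integral_deriv_mul_eq_neg_of_hasDerivAt {m m' φ : ℝ → ℝ} (hφ : IsTest (Ioi 0) φ)
    (hm : ContinuousOn m (Ici 0)) (hd : ∀ t, 0 < t → HasDerivAt m (m' t) t)
    (hm' : MemLp m' 2 (volume.restrict (Ioi (0 : ℝ)))) :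
    ∫ t in Ioi (0 : ℝ), deriv φ t * m t = -∫ t in Ioi (0 : ℝ), φ t * m' t := by
  have i1 : IntegrableOn (fun t => deriv φ t * m t) (Ioi 0) :=
    integrableOn_mul_of_hasCompactSupport hφ.deriv_continuous hφ.2.1.deriv hm
  have i2 : IntegrableOn (fun t => φ t * m' t) (Ioi 0) :=
    ((hφ.1.continuous.memLp_of_hasCompactSupport (p := 2) hφ.2.1).restrict _).integrable_mul hm'
  have hcont : ContinuousWithinAt (fun t => φ t * m t) (Ici 0) 0 :=
    hφ.1.continuous.continuousWithinAt.mul (hm 0 self_mem_Ici)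
  have hlim : Tendsto (fun t => φ t * m t) atTop (𝓝 0) := by
    obtain ⟨T, hT⟩ := hφ.2.1.isCompact.bddAbove
    refine tendsto_const_nhds.congr' ?_
    filter_upwards [eventually_gt_atTop T] with t ht
    have : φ t = 0 := image_eq_zero_of_notMem_tsupport fun h => not_lt.2 (hT h) ht
    simp [this]
  have h := integral_Ioi_of_hasDerivAt_of_tendsto hcont
    (f' := fun t => deriv φ t * m t + φ t * m' t)
    (fun t ht => (hφ.hasDerivAt t).mul (hd t ht)) (i1.add i2) hlim
  rw [integral_add i1 i2, hφ.eq_zero_of_notMem (by simp : (0 : ℝ) ∉ Ioi 0)] at h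
  linarith

end WeakDerivative

/-! ### The du Bois-Reymond lemma and weak linear equations. -/

section DuBoisReymond

theorem IsTest.mul_contDiff {s : Set ℝ} {φ h : ℝ → ℝ} (hφ : IsTest s φ) (hh : ContDiff ℝ ∞ h) :
    IsTest s fun t => φ t * h t :=
  ⟨hφ.1.mul hh, hφ.2.1.mul_right, (tsupport_mul_subset_left (f := φ) (g := h)).trans hφ.2.2⟩

theorem IsTest.sub {s : Set ℝ} {φ ψ : ℝ → ℝ} (hφ : IsTest s φ) (hψ : IsTest s ψ) :
    IsTest s fun t => φ t - ψ t :=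
  ⟨hφ.1.sub hψ.1, hφ.2.1.sub hψ.2.1,
    (tsupport_sub φ ψ).trans (union_subset hφ.2.2 hψ.2.2)⟩

theorem IsTest.const_mul {s : Set ℝ} {φ : ℝ → ℝ} (hφ : IsTest s φ) (c : ℝ) :
    IsTest s fun t => c * φ t := by
  simpa [mul_comm] using hφ.mul_contDiff (contDiff_const (c := c))

theorem IsTest.integrable {s : Set ℝ} {φ : ℝ → ℝ} (hφ : IsTest s φ) : Integrable φ :=
  hφ.1.continuous.integrable_of_hasCompactSupport hφ.2.1

theorem IsTest.integrable_mul_continuousOn {s : Set ℝ} {φ q : ℝ → ℝ} (hφ : IsTest s φ)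
    (hq : ContinuousOn q s) : Integrable fun t => φ t * q t := by
  have h1 : IntegrableOn (fun t => φ t * q t) (tsupport φ) :=
    (hφ.1.continuous.continuousOn.mul (hq.mono hφ.2.2)).integrableOn_compact hφ.2.1
  refine (integrableOn_iff_integrable_of_support_subset fun t ht => ?_).1 h1
  exact subset_tsupport φ (left_ne_zero_of_mul ht)

theorem IsTest.setIntegral_mul {s : Set ℝ} {φ q : ℝ → ℝ} (hφ : IsTest s φ) :
    ∫ t in s, φ t * q t = ∫ t, φ t * q t :=
  setIntegral_eq_integral_of_forall_compl_eq_zero fun t ht => by simp [hφ.eq_zero_of_notMem ht]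

theorem exists_isTest_integral_eq_one {s : Set ℝ} (hs : IsOpen s) (hne : s.Nonempty) :
    ∃ η : ℝ → ℝ, IsTest s η ∧ ∫ t, η t = 1 := by
  obtain ⟨c, hc⟩ := hne
  obtain ⟨ε, hε, hb⟩ := Metric.isOpen_iff.1 hs c hc
  let B : ContDiffBump c := ⟨ε / 4, ε / 2, by positivity, by linarith⟩
  refine ⟨B.normed volume, ⟨B.contDiff_normed, B.hasCompactSupport_normed, ?_⟩, B.integral_normed⟩
  rw [B.tsupport_normed_eq]
  exact (Metric.closedBall_subset_ball (by show ε / 2 < ε; linarith)).trans hb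

/-- The primitive started to the left of the support is constant to its right, with value the total
integral, hence zero. Its support lies between the extreme points `p, q` of that of `χ`, and
order-connectedness keeps `[p, q]` inside `s`. -/
theorem IsTest.exists_antideriv {s : Set ℝ} (hs : s.OrdConnected) {χ : ℝ → ℝ} (hχ : IsTest s χ)
    (h0 : ∫ t, χ t = 0) : ∃ ψ : ℝ → ℝ, IsTest s ψ ∧ deriv ψ = χ := by
  rcases (tsupport χ).eq_empty_or_nonempty with he | hne
  · have hz : χ = 0 := tsupport_eq_empty_iff.1 he
    exact ⟨0, by rw [← hz]; exact hχ, by rw [hz]; ext; simp⟩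
  obtain ⟨p, hp, hpK⟩ := hχ.2.1.isCompact.exists_isLeast hne
  obtain ⟨q, hq, hqK⟩ := hχ.2.1.isCompact.exists_isGreatest hne
  have hlow : ∀ t, t < p → χ t = 0 := fun t ht =>
    image_eq_zero_of_notMem_tsupport fun h => not_lt.2 (hpK h) ht
  have hup : ∀ t, q < t → χ t = 0 := fun t ht =>
    image_eq_zero_of_notMem_tsupport fun h => not_lt.2 (hqK h) ht
  -- The base point is `p - 1` and not `p` because the interval integral is over a left-open
  -- interval, which has to contain the whole support.
  have hd : ∀ t, HasDerivAt (fun t => ∫ x in (p - 1)..t, χ x) (χ t) t := fun t =>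
    intervalIntegral.integral_hasDerivAt_right (hχ.1.continuous.intervalIntegrable _ _)
      hχ.1.continuous.stronglyMeasurable.stronglyMeasurableAtFilter hχ.1.continuous.continuousAt
  have hderiv : deriv (fun t => ∫ x in (p - 1)..t, χ x) = χ := funext fun t => (hd t).deriv
  have hsupp : tsupport (fun t => ∫ x in (p - 1)..t, χ x) ⊆ Icc p q := by
    refine closure_minimal (fun t ht => ?_) isClosed_Icc
    by_contra hn
    refine ht ?_
    rcases lt_or_ge t p with h | h
    · refine (intervalIntegral.integral_congr (g := fun _ => 0) fun x hx => hlow x ?_).trans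
        (by simp)
      exact lt_of_le_of_lt hx.2 (max_lt (by linarith) h)
    · have hqt : q < t := not_le.1 fun h' => hn ⟨h, h'⟩
      show ∫ x in (p - 1)..t, χ x = 0
      rw [intervalIntegral.integral_eq_integral_of_support_subset, h0]
      intro x hx
      have hx' := subset_tsupport χ hx
      exact ⟨by linarith [hpK hx'], by linarith [hqK hx']⟩
  refine ⟨_, ⟨?_, HasCompactSupport.of_support_subset_isCompact isCompact_Icc
    ((subset_tsupport _).trans hsupp), hsupp.trans (hs.out (hχ.2.2 hp) (hχ.2.2 hq))⟩, hderiv⟩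
  rw [contDiff_infty_iff_deriv, hderiv]
  exact ⟨fun t => (hd t).differentiableAt, hχ.1⟩

/-- The du Bois-Reymond lemma for continuous functions. -/
theorem exists_eqOn_const_of_integral_deriv_mul_eq_zero {s : Set ℝ} (hs : IsOpen s)
    (hc : s.OrdConnected) (hne : s.Nonempty) {q : ℝ → ℝ} (hq : ContinuousOn q s)
    (h : ∀ ψ, IsTest s ψ → ∫ t in s, deriv ψ t * q t = 0) : ∃ C, ∀ t ∈ s, q t = C := by
  obtain ⟨η, hη, hη1⟩ := exists_isTest_integral_eq_one hs hne
  refine ⟨∫ t, η t * q t, ?_⟩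
  set C := ∫ t, η t * q t
  have hae : ∀ᵐ t, t ∈ s → q t - C = 0 := by
    refine hs.ae_eq_zero_of_integral_contDiff_smul_eq_zero
      ((hq.sub continuousOn_const).locallyIntegrableOn hs.measurableSet) fun χ h1 h2 h3 => ?_
    have hχ : IsTest s χ := ⟨h1, h2, h3⟩
    -- Subtracting a multiple of the unit-mass `η` makes the mean zero, so the difference is a
    -- derivative of a test function.
    have hχη : IsTest s fun t => χ t - (∫ t, χ t) * η t := hχ.sub (hη.const_mul _)
    obtain ⟨ψ, hψ, hψd⟩ := hχη.exists_antideriv hc (by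
      rw [integral_sub hχ.integrable (hη.integrable.const_mul _), integral_const_mul, hη1]; ring)
    have h4 := h ψ hψ
    rw [hψd, hχη.setIntegral_mul] at h4
    simp only [sub_mul, mul_assoc] at h4
    rw [integral_sub (hχ.integrable_mul_continuousOn hq)
      ((hη.integrable_mul_continuousOn hq).const_mul _), integral_const_mul] at h4
    simp only [smul_eq_mul, mul_sub]
    rw [integral_sub (hχ.integrable_mul_continuousOn hq) (hχ.integrable.mul_const _),
      integral_mul_const]
    exact h4
  have h5 := Measure.eqOn_open_of_ae_eq (μ := volume) (U := s) (f := fun t => q t - C)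
    (g := fun _ => 0) ((ae_restrict_iff' hs.measurableSet).2 hae) hs (hq.sub continuousOn_const)
    continuousOn_const
  exact fun t ht => sub_eq_zero.1 (h5 ht)

/-- A continuous weak solution on `[0, ∞)` of `m' = -c m` is an exponential. -/
theorem eq_mul_exp_of_weak_deriv {m : ℝ → ℝ} (hm : ContinuousOn m (Ici 0)) {c : ℝ}
    (h : ∀ φ, IsTest (Ioi 0) φ →
      ∫ t in Ioi (0 : ℝ), deriv φ t * m t = ∫ t in Ioi (0 : ℝ), φ t * (c * m t))
    {t : ℝ} (ht : 0 ≤ t) : m t = m 0 * Real.exp (-c * t) := by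
  have hm0 : ContinuousOn m (Ioi 0) := hm.mono Ioi_subset_Ici_self
  have hexp : ContDiff ℝ ∞ fun t : ℝ => Real.exp (c * t) := by fun_prop
  have hqc : ContinuousOn (fun t => Real.exp (c * t) * m t) (Ici 0) :=
    hexp.continuous.continuousOn.mul hm
  obtain ⟨C, hC⟩ := exists_eqOn_const_of_integral_deriv_mul_eq_zero isOpen_Ioi ordConnected_Ioi
    ⟨1, mem_Ioi.2 one_pos⟩ (hqc.mono Ioi_subset_Ici_self) fun ψ hψ => by
      -- Integrating factor: testing against `ψ * exp (c t)` shows that `exp (c t) * m` has zero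
      -- weak derivative.
      have hφ := hψ.mul_contDiff hexp
      have h1 := h _ hφ
      have hd : ∀ t, deriv (fun t => ψ t * Real.exp (c * t)) t =
          deriv ψ t * Real.exp (c * t) + ψ t * (Real.exp (c * t) * c) := fun t => by
        have h2 : HasDerivAt (fun t => Real.exp (c * t)) (Real.exp (c * t) * c) t := by
          simpa using ((hasDerivAt_id t).const_mul c).exp
        exact ((hψ.hasDerivAt t).mul h2).deriv
      have i1 : IntegrableOn (fun t => deriv ψ t * (Real.exp (c * t) * m t)) (Ioi 0) :=
        integrableOn_mul_of_hasCompactSupport hψ.deriv_continuous hψ.2.1.deriv hqc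
      have i2 : IntegrableOn (fun t => ψ t * Real.exp (c * t) * (c * m t)) (Ioi 0) :=
        (hφ.integrable_mul_continuousOn (continuousOn_const.mul hm0)).integrableOn
      have e : ∀ t, deriv (fun t => ψ t * Real.exp (c * t)) t * m t =
          deriv ψ t * (Real.exp (c * t) * m t) + ψ t * Real.exp (c * t) * (c * m t) := fun t => by
        rw [hd]; ring
      simp only [e] at h1
      rw [integral_add i1 i2] at h1
      linarith
  -- The constant is known only on the open half-line; continuity of `m` at `0` from the right
  -- identifies it with `m 0`.
  have hlim : Tendsto (fun t => Real.exp (c * t) * m t) (𝓝[>] 0) (𝓝 (m 0)) := by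
    have := (hqc 0 self_mem_Ici).mono_left (nhdsWithin_mono (0 : ℝ) Ioi_subset_Ici_self)
    simpa using this
  have hC0 : m 0 = C := by
    refine tendsto_nhds_unique hlim (tendsto_const_nhds.congr' ?_)
    filter_upwards [self_mem_nhdsWithin] with t ht using (hC t ht).symm
  rcases ht.eq_or_lt with rfl | ht
  · simp
  · rw [hC0, ← hC t ht, mul_right_comm, ← Real.exp_add]
    simp

end DuBoisReymond

/-! ### Parity and trigonometric integrals on the symmetric interval. -/

section TrigIntegrals

variable {a : ℝ}

theorem setIntegral_Ioo_eq_intervalIntegral {E : Type*} [NormedAddCommGroup E] [NormedSpace ℝ E]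
    (ha : 0 < a) (h : ℝ → E) : ∫ x in Ioo (-a) a, h x = ∫ x in (-a)..a, h x := by
  rw [intervalIntegral.integral_of_le (by linarith), integral_Ioc_eq_integral_Ioo]

theorem measurePreserving_neg_muI (a : ℝ) :
    MeasurePreserving (fun x : ℝ => -x) (muI a) (muI a) := by
  have h := (Measure.measurePreserving_neg (volume : Measure ℝ)).restrict_preimage
    (measurableSet_Ioo (a := -a) (b := a))
  have e : (fun x : ℝ => -x) ⁻¹' Ioo (-a) a = Ioo (-a) a := by ext x; simp [and_comm]
  change MeasurePreserving (fun x : ℝ => -x) (volume.restrict ((fun x : ℝ => -x) ⁻¹' _)) _ at h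
  rwa [e] at h

theorem integral_comp_neg_muI {E : Type*} [NormedAddCommGroup E] [NormedSpace ℝ E] (a : ℝ)
    (h : ℝ → E) : ∫ x in Ioo (-a) a, h (-x) = ∫ x in Ioo (-a) a, h x :=
  (measurePreserving_neg_muI a).integral_comp (Homeomorph.neg ℝ).measurableEmbedding h

theorem integral_eq_zero_of_odd {h : ℝ → ℝ} (hh : ∀ᵐ x ∂(muI a), h (-x) = -h x) :
    ∫ x in Ioo (-a) a, h x = 0 := by
  have h1 := integral_comp_neg_muI a h
  rw [integral_congr_ae hh, integral_neg] at h1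
  linarith

theorem measurable_A (k : ℝ) : Measurable (A k) :=
  Measurable.ite measurableSet_Iio measurable_const measurable_const

theorem abs_A_le (k x : ℝ) : |A k x| ≤ 1 + |k| := by
  unfold A
  split_ifs
  · linarith
  · rw [abs_one]; linarith [abs_nonneg k]

theorem integrable_A_mul {k : ℝ} {μ : Measure ℝ} {h : ℝ → ℝ} (hh : Integrable h μ) :
    Integrable (fun x => A k x * h x) μ :=
  hh.bdd_mul (measurable_A k).aestronglyMeasurable (Eventually.of_forall (abs_A_le k))

/-- Reflection replaces `A` by `k + 1 - A` off `0`, so only the even part `(k + 1) / 2` of `A` is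
seen by an even function. -/
theorem integral_A_mul_of_even {k : ℝ} {h : ℝ → ℝ} (hi : IntegrableOn h (Ioo (-a) a))
    (hh : ∀ᵐ x ∂(muI a), h (-x) = h x) :
    ∫ x in Ioo (-a) a, A k x * h x = (k + 1) / 2 * ∫ x in Ioo (-a) a, h x := by
  have h1 := integral_comp_neg_muI a fun x => A k x * h x
  have hne : ∀ᵐ x ∂(muI a), x ≠ 0 := ae_restrict_of_ae (Measure.ae_ne volume 0)
  have h2 : ∫ x in Ioo (-a) a, A k (-x) * h (-x) =
      ∫ x in Ioo (-a) a, ((k + 1) * h x - A k x * h x) := by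
    refine integral_congr_ae ?_
    filter_upwards [hh, hne] with x hx h0
    rw [hx, ← sub_mul]
    congr 1
    unfold A
    rcases lt_or_gt_of_ne h0 with h | h
    · rw [if_pos h, if_neg (by linarith)]; ring
    · rw [if_pos (by linarith), if_neg (by linarith)]; ring
  rw [h2, integral_sub (hi.const_mul _) (integrable_A_mul hi), integral_const_mul] at h1
  linarith

theorem integral_cos_int_mul_pi_div (ha : 0 < a) (m : ℤ) :
    ∫ x in Ioo (-a) a, Real.cos (m * Real.pi / a * x) = if m = 0 then 2 * a else 0 := by
  rw [setIntegral_Ioo_eq_intervalIntegral ha]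
  split_ifs with hm
  · simp [hm]; ring
  · have h0 : (m : ℝ) * Real.pi / a ≠ 0 := by
      have := Real.pi_ne_zero
      have : (m : ℝ) ≠ 0 := by exact_mod_cast hm
      positivity
    rw [intervalIntegral.integral_comp_mul_left (fun x => Real.cos x) h0, integral_cos]
    have e : (m : ℝ) * Real.pi / a * a = m * Real.pi := by field_simp
    rw [mul_neg, e, Real.sin_neg, Real.sin_int_mul_pi]
    simp

/-- `cos (θ x)` or `sin (θ x)`. -/
def osc (b : Bool) (θ x : ℝ) : ℝ := if b then Real.cos (θ * x) else Real.sin (θ * x)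

theorem continuous_osc (b : Bool) (θ : ℝ) : Continuous (osc b θ) := by
  unfold osc; cases b <;> simp <;> fun_prop

theorem abs_osc_le_one (b : Bool) (θ x : ℝ) : |osc b θ x| ≤ 1 := by
  unfold osc; cases b <;> simp [Real.abs_cos_le_one, Real.abs_sin_le_one]

/-- The frequencies: `λ_{n+1}` at `(n, true)` and `μ_{n+1}` at `(n, false)`. -/
def freq (a : ℝ) (i : ℕ × Bool) : ℝ := if i.2 then lam a (i.1 + 1) else mu a (i.1 + 1)

theorem integral_osc_mul_osc_of_ne {b c : Bool} (hbc : b ≠ c) (α β : ℝ) :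
    ∫ x in Ioo (-a) a, osc b α x * osc c β x = 0 := by
  refine integral_eq_zero_of_odd (Eventually.of_forall fun x => ?_)
  cases b <;> cases c <;> simp_all [osc]

theorem integrableOn_of_continuous {h : ℝ → ℝ} (hh : Continuous h) :
    IntegrableOn h (Ioo (-a) a) :=
  (hh.integrableOn_Icc (a := -a) (b := a)).mono_set Ioo_subset_Icc_self

theorem integral_osc_mul_osc (ha : 0 < a) (b : Bool) {α β : ℝ} {p q : ℤ}
    (hp : α - β = p * Real.pi / a) (hq : α + β = q * Real.pi / a) (hq0 : q ≠ 0) :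
    ∫ x in Ioo (-a) a, osc b α x * osc b β x = if p = 0 then a else 0 := by
  have i : ∀ m : ℤ, IntegrableOn (fun x => Real.cos (m * Real.pi / a * x)) (Ioo (-a) a) :=
    fun m => integrableOn_of_continuous (by fun_prop)
  have e : ∀ x, osc b α x * osc b β x = 1 / 2 * Real.cos (p * Real.pi / a * x) +
      (if b then 1 / 2 else -(1 / 2)) * Real.cos (q * Real.pi / a * x) := by
    intro x
    rw [← hp, ← hq, sub_mul, add_mul, Real.cos_sub, Real.cos_add]
    cases b <;> simp [osc] <;> ring
  simp only [e]
  rw [integral_add ((i p).const_mul _) ((i q).const_mul _), integral_const_mul,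
    integral_const_mul, integral_cos_int_mul_pi_div ha, integral_cos_int_mul_pi_div ha, if_neg hq0]
  split_ifs <;> ring

/-- Opposite parities cancel by oddness; for equal parities, sums and differences of frequencies are
integer multiples of `π / a`. The flag `r` exchanges cosines and sines: `false` gives the profiles
of the eigenfunctions, `true` those of their derivatives. -/
theorem integral_osc_freq (ha : 0 < a) (r : Bool) (i j : ℕ × Bool) :
    ∫ x in Ioo (-a) a, osc (r ^^ i.2) (freq a i) x * osc (r ^^ j.2) (freq a j) x =
      if i = j then a else 0 := by
  obtain ⟨n, b⟩ := i
  obtain ⟨m, c⟩ := j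
  by_cases hbc : b = c
  · subst hbc
    have h0 : freq a (n, b) - freq a (m, b) = ((n - m : ℤ) : ℝ) * Real.pi / a := by
      cases b <;> simp [freq, lam, mu] <;> field_simp <;> ring
    have h1 : freq a (n, b) + freq a (m, b) =
        ((n + m + (if b then 1 else 2) : ℤ) : ℝ) * Real.pi / a := by
      cases b <;> simp [freq, lam, mu] <;> field_simp <;> ring
    rw [integral_osc_mul_osc ha _ h0 h1 (by split_ifs <;> omega)]
    simp [sub_eq_zero]
  · rw [integral_osc_mul_osc_of_ne (by simpa using hbc), if_neg (by simp [hbc])]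

theorem freq_lower_bound (ha : 0 < a) (i : ℕ × Bool) :
    (i.1 + 1 : ℝ) * (Real.pi / (2 * a)) ≤ freq a i := by
  have := Real.pi_pos
  obtain ⟨n, b⟩ := i
  have hn := n.cast_nonneg (α := ℝ)
  have h : 0 < Real.pi / (2 * a) := by positivity
  cases b
  · have e : freq a (n, false) = 2 * (n + 1) * (Real.pi / (2 * a)) := by
      simp [freq, mu]; field_simp
    rw [e]; simp only; nlinarith
  · have e : freq a (n, true) = (2 * (n + 1) - 1) * (Real.pi / (2 * a)) := by
      simp [freq, lam]; field_simp
    rw [e]; simp only; nlinarith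

end TrigIntegrals

/-! ### Orthonormal oscillations and multiplication operators on `L²(I)`. -/

section L2

variable {a : ℝ}

theorem inner_L2I (u v : L2I a) : inner ℝ u v = ∫ x in Ioo (-a) a, u x * v x := by
  rw [L2.inner_def]
  refine integral_congr_ae (Eventually.of_forall fun x => ?_)
  simp [mul_comm]

theorem memLp_osc (a : ℝ) (b : Bool) (θ : ℝ) : MemLp (osc b θ) 2 (muI a) :=
  MemLp.of_bound (continuous_osc b θ).aestronglyMeasurable 1
    (Eventually.of_forall (abs_osc_le_one b θ))

/-- `cos (θ x)` or `sin (θ x)` as an element of `L²(I)`. -/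
def oscL (a : ℝ) (b : Bool) (θ : ℝ) : L2I a := (memLp_osc a b θ).toLp _

theorem coeFn_oscL (a : ℝ) (b : Bool) (θ : ℝ) : oscL a b θ =ᵐ[muI a] osc b θ := MemLp.coeFn_toLp _

theorem orthonormal_oscL (ha : 0 < a) (r : Bool) :
    Orthonormal ℝ fun i : ℕ × Bool => (√a)⁻¹ • oscL a (r ^^ i.2) (freq a i) := by
  classical
  rw [orthonormal_iff_ite]
  intro i j
  rw [inner_smul_left, inner_smul_right, inner_L2I]
  have : ∫ x in Ioo (-a) a, oscL a (r ^^ i.2) (freq a i) x * oscL a (r ^^ j.2) (freq a j) x =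
      if i = j then a else 0 := by
    rw [← integral_osc_freq ha r]
    refine integral_congr_ae ?_
    filter_upwards [coeFn_oscL a (r ^^ i.2) (freq a i), coeFn_oscL a (r ^^ j.2) (freq a j)]
      with x h1 h2
    rw [h1, h2]
  rw [this]
  split_ifs
  · simp only [conj_trivial]
    rw [← mul_assoc, ← mul_inv, Real.mul_self_sqrt ha.le, inv_mul_cancel₀ ha.ne']
  · simp

theorem memLp_bdd_mul {m : ℝ → ℝ} (hm : Measurable m) {C : ℝ} (hC : ∀ x, |m x| ≤ C) (u : L2I a) :
    MemLp (fun x => m x * u x) 2 (muI a) :=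
  (Lp.memLp u).of_le_mul (c := C) (hm.aestronglyMeasurable.mul (Lp.aestronglyMeasurable u))
    (Eventually.of_forall fun x => by
      rw [norm_mul]; exact mul_le_mul_of_nonneg_right (hC x) (norm_nonneg _))

/-- Multiplication by a bounded measurable function, on `L²(I)`. -/
def mulL (a : ℝ) (m : ℝ → ℝ) (hm : Measurable m) (C : ℝ) (hC : ∀ x, |m x| ≤ C) :
    L2I a →L[ℝ] L2I a :=
  LinearMap.mkContinuous
    { toFun := fun u => (memLp_bdd_mul hm hC u).toLp _
      map_add' := fun u v => by
        rw [← MemLp.toLp_add]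
        refine MemLp.toLp_congr _ _ ?_
        filter_upwards [Lp.coeFn_add u v] with x hx
        rw [hx]; simp [mul_add]
      map_smul' := fun c u => by
        rw [RingHom.id_apply, ← MemLp.toLp_const_smul]
        refine MemLp.toLp_congr _ _ ?_
        filter_upwards [Lp.coeFn_smul c u] with x hx
        rw [hx]; simp [mul_left_comm] } C
    fun u => by
      refine Lp.norm_le_mul_norm_of_ae_le_mul ?_
      filter_upwards [(memLp_bdd_mul hm hC u).coeFn_toLp] with x hx
      simp only [LinearMap.coe_mk, AddHom.coe_mk, hx]
      rw [norm_mul]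
      exact mul_le_mul_of_nonneg_right (hC x) (norm_nonneg _)

theorem coeFn_mulL {m : ℝ → ℝ} {hm : Measurable m} {C : ℝ} {hC : ∀ x, |m x| ≤ C} (u : L2I a) :
    mulL a m hm C hC u =ᵐ[muI a] fun x => m x * u x :=
  MemLp.coeFn_toLp (memLp_bdd_mul hm hC u)

/-- Multiplication by the conductivity. -/
def AL (a k : ℝ) : L2I a →L[ℝ] L2I a := mulL a (A k) (measurable_A k) _ (abs_A_le k)

theorem inner_AL (k : ℝ) (u v : L2I a) :
    inner ℝ (AL a k u) v = ∫ x in Ioo (-a) a, A k x * u x * v x := by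
  rw [inner_L2I]
  refine integral_congr_ae ?_
  filter_upwards [coeFn_mulL (hm := measurable_A k) (hC := abs_A_le k) u] with x hx
  rw [AL, hx]

end L2

/-! ### Completeness of the trigonometric systems. -/

section Completeness

variable {a : ℝ}

/-- Parseval's identity on the interval of length `2a`. -/
theorem ae_eq_zero_of_fourierCoeffOn_eq_zero (ha : 0 < a) {h : ℝ → ℂ} (hh : MemLp h 2 (muI a))
    (h0 : ∀ m : ℤ, ∫ x in Ioo (-a) a,
      Complex.exp (-((m * Real.pi / a * x : ℝ) * Complex.I)) * h x = 0) :
    ∀ᵐ x ∂(muI a), h x = 0 := by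
  have hab : -a < a := by linarith
  have hh' : MemLp h 2 (volume.restrict (Ioc (-a) a)) := by rwa [← restrict_Ioo_eq_restrict_Ioc]
  have hcoef : ∀ m : ℤ, fourierCoeffOn hab h m = 0 := by
    intro m
    rw [fourierCoeffOn_eq_integral, ← setIntegral_Ioo_eq_intervalIntegral ha]
    refine smul_eq_zero_of_right _ ((integral_congr_ae (Eventually.of_forall fun x => ?_)).trans
      (h0 m))
    simp only [fourier_coe_apply, smul_eq_mul]
    congr 2
    push_cast
    have : (a : ℂ) ≠ 0 := by exact_mod_cast ha.ne'
    field_simp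
    ring
  have hP := tsum_sq_fourierCoeffOn hab hh'
  simp only [hcoef, norm_zero, ne_eq, OfNat.ofNat_ne_zero, not_false_eq_true, zero_pow,
    tsum_zero] at hP
  have hI : ∫ x in Ioo (-a) a, ‖h x‖ ^ 2 = 0 := by
    rw [setIntegral_Ioo_eq_intervalIntegral ha]
    have h2 : (a - -a)⁻¹ ≠ 0 := inv_ne_zero (by linarith)
    exact (smul_eq_zero.1 hP.symm).resolve_left h2
  have h3 := (integral_eq_zero_iff_of_nonneg (fun x => by positivity)
    hh.integrable_norm_pow').1 hI
  filter_upwards [h3] with x hx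
  simpa using hx

/-- Multiplying `h` by `exp (iσx)` shifts its frequencies by `σ`, so the modulated function has
vanishing Fourier coefficients. The shift gives access to the half-integer frequencies `λ_n`. -/
theorem ae_eq_zero_of_integral_trig_eq_zero (ha : 0 < a) {h : ℝ → ℝ} (hh : MemLp h 2 (muI a))
    (σ : ℝ)
    (hc : ∀ m : ℤ, ∫ x in Ioo (-a) a, Real.cos ((m * Real.pi / a - σ) * x) * h x = 0)
    (hs : ∀ m : ℤ, ∫ x in Ioo (-a) a, Real.sin ((m * Real.pi / a - σ) * x) * h x = 0) :
    ∀ᵐ x ∂(muI a), h x = 0 := by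
  have hint : IntegrableOn h (Ioo (-a) a) := hh.integrable one_le_two
  have hexp : Continuous fun x : ℝ => Complex.exp ((σ * x : ℝ) * Complex.I) := by fun_prop
  have hmem : MemLp (fun x => Complex.exp ((σ * x : ℝ) * Complex.I) * (h x : ℂ)) 2 (muI a) := by
    refine hh.of_le_mul (c := 1) (hexp.aestronglyMeasurable.mul
      (Complex.continuous_ofReal.comp_aestronglyMeasurable hh.1))
      (Eventually.of_forall fun x => ?_)
    rw [norm_mul, Complex.norm_exp_ofReal_mul_I]
    simp
  have key := ae_eq_zero_of_fourierCoeffOn_eq_zero ha hmem fun m => by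
    set θ : ℝ := m * Real.pi / a - σ
    have e : ∀ x : ℝ, Complex.exp (-((m * Real.pi / a * x : ℝ) * Complex.I)) *
        (Complex.exp ((σ * x : ℝ) * Complex.I) * (h x : ℂ)) =
        ((Real.cos (θ * x) * h x : ℝ) : ℂ) - ((Real.sin (θ * x) * h x : ℝ) : ℂ) * Complex.I := by
      intro x
      rw [← mul_assoc, ← Complex.exp_add]
      have : -(((m * Real.pi / a * x : ℝ) : ℂ) * Complex.I) + ((σ * x : ℝ) : ℂ) * Complex.I =
          ((-(θ * x) : ℝ) : ℂ) * Complex.I := by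
        simp only [θ]; push_cast; ring
      rw [this, Complex.exp_mul_I, ← Complex.ofReal_cos, ← Complex.ofReal_sin, Real.cos_neg,
        Real.sin_neg]
      push_cast; ring
    simp only [e]
    have i1 : IntegrableOn (fun x => Real.cos (θ * x) * h x) (Ioo (-a) a) :=
      hint.bdd_mul (c := 1) (by fun_prop) (Eventually.of_forall fun x => Real.abs_cos_le_one _)
    have i2 : IntegrableOn (fun x => Real.sin (θ * x) * h x) (Ioo (-a) a) :=
      hint.bdd_mul (c := 1) (by fun_prop) (Eventually.of_forall fun x => Real.abs_sin_le_one _)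
    rw [integral_sub i1.ofReal (i2.ofReal.mul_const _), integral_mul_const,
      integral_complex_ofReal, integral_complex_ofReal, hc, hs]
    simp
  filter_upwards [key] with x hx
  simpa using hx

/-- The function `u (-x) - u x` is odd, so its cosine coefficients vanish by parity and its sine
coefficients by hypothesis. -/
theorem ae_even_of_integral_sin_eq_zero (ha : 0 < a) {u : ℝ → ℝ} (hu : MemLp u 2 (muI a))
    (h : ∀ n : ℕ, ∫ x in Ioo (-a) a, u x * Real.sin (mu a (n + 1) * x) = 0) :
    ∀ᵐ x ∂(muI a), u (-x) = u x := by
  have hint : IntegrableOn u (Ioo (-a) a) := hu.integrable one_le_two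
  have hun : MemLp (fun x => u (-x)) 2 (muI a) :=
    hu.comp_measurePreserving (measurePreserving_neg_muI a)
  have hintn : IntegrableOn (fun x => u (-x)) (Ioo (-a) a) := hun.integrable one_le_two
  have hsin : ∀ m : ℤ, ∫ x in Ioo (-a) a, Real.sin (m * Real.pi / a * x) * u x = 0 := by
    intro m
    rcases lt_trichotomy m 0 with hm | rfl | hm
    · obtain ⟨n, rfl⟩ : ∃ n : ℕ, m = -(n + 1 : ℤ) := ⟨(-m - 1).toNat, by omega⟩
      rw [← neg_eq_zero, ← integral_neg, ← h n]
      refine integral_congr_ae (Eventually.of_forall fun x => ?_)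
      simp only [mu]
      push_cast
      rw [show -((n : ℝ) + 1) * Real.pi / a * x = -((n + 1) * Real.pi / a * x) by ring,
        Real.sin_neg]
      ring
    · simp
    · obtain ⟨n, rfl⟩ : ∃ n : ℕ, m = (n + 1 : ℤ) := ⟨(m - 1).toNat, by omega⟩
      rw [← h n]
      refine integral_congr_ae (Eventually.of_forall fun x => ?_)
      simp only [mu]
      push_cast
      ring
  have key := ae_eq_zero_of_integral_trig_eq_zero ha (hun.sub hu) 0 (fun m => ?_) fun m => ?_
  · filter_upwards [key] with x hx
    exact sub_eq_zero.1 hx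
  · refine integral_eq_zero_of_odd (Eventually.of_forall fun x => ?_)
    simp only [Pi.sub_apply, mul_neg, Real.cos_neg, neg_neg]
    ring
  · simp only [sub_zero, Pi.sub_apply, mul_sub]
    have b : ∀ {v : ℝ → ℝ}, IntegrableOn v (Ioo (-a) a) →
        IntegrableOn (fun x => Real.sin (m * Real.pi / a * x) * v x) (Ioo (-a) a) := fun hv =>
      hv.bdd_mul (c := 1) (by fun_prop) (Eventually.of_forall fun x => Real.abs_sin_le_one _)
    rw [integral_sub (b hintn) (b hint), hsin, sub_zero,
      ← integral_comp_neg_muI a fun x => Real.sin (m * Real.pi / a * x) * u (-x)]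
    simp only [neg_neg, mul_neg, Real.sin_neg, neg_mul]
    rw [integral_neg, hsin, neg_zero]

/-- With the shift `π / (2a)`, the frequencies `mπ / a - π / (2a)` for integer `m` are exactly the
numbers `±λ_n`. The sine integrals vanish because `u` is even. -/
theorem ae_eq_zero_of_even_of_integral_cos_eq_zero (ha : 0 < a) {u : ℝ → ℝ}
    (hu : MemLp u 2 (muI a)) (he : ∀ᵐ x ∂(muI a), u (-x) = u x)
    (h : ∀ n : ℕ, ∫ x in Ioo (-a) a, u x * Real.cos (lam a (n + 1) * x) = 0) :
    ∀ᵐ x ∂(muI a), u x = 0 := by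
  refine ae_eq_zero_of_integral_trig_eq_zero ha hu (Real.pi / (2 * a)) (fun m => ?_) fun m => ?_
  · rcases le_or_gt m 0 with hm | hm
    · obtain ⟨n, rfl⟩ : ∃ n : ℕ, m = -(n : ℤ) := ⟨(-m).toNat, by omega⟩
      rw [← h n]
      refine integral_congr_ae (Eventually.of_forall fun x => ?_)
      simp only
      rw [show ((-(n : ℤ) : ℤ) * Real.pi / a - Real.pi / (2 * a)) * x = -(lam a (n + 1) * x) by
        simp only [lam]; push_cast; field_simp; ring, Real.cos_neg, mul_comm]
    · obtain ⟨n, rfl⟩ : ∃ n : ℕ, m = (n + 1 : ℤ) := ⟨(m - 1).toNat, by omega⟩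
      rw [← h n]
      refine integral_congr_ae (Eventually.of_forall fun x => ?_)
      simp only
      rw [show (((n : ℤ) + 1 : ℤ) * Real.pi / a - Real.pi / (2 * a)) * x = lam a (n + 1) * x by
        simp only [lam]; push_cast; field_simp, mul_comm]
  · refine integral_eq_zero_of_odd ?_
    filter_upwards [he] with x hx
    rw [hx, mul_neg, Real.sin_neg, neg_mul]

end Completeness

/-! ### The space `H¹₀(I)`: membership and integration by parts. -/

section Sobolev

variable {a : ℝ}

instance (a : ℝ) : CompleteSpace (H10 a) := Submodule.topologicalClosure.completeSpace _

theorem IsTest.memLp {s : Set ℝ} {φ : ℝ → ℝ} (hφ : IsTest s φ) : MemLp φ 2 (muI a) :=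
  (hφ.1.continuous.memLp_of_hasCompactSupport (p := 2) hφ.2.1).restrict _

theorem IsTest.deriv_memLp {s : Set ℝ} {φ : ℝ → ℝ} (hφ : IsTest s φ) :
    MemLp (deriv φ) 2 (muI a) :=
  (hφ.deriv_continuous.memLp_of_hasCompactSupport (p := 2) hφ.2.1.deriv).restrict _

theorem isTest_zero (s : Set ℝ) : IsTest s 0 :=
  ⟨contDiff_const, HasCompactSupport.zero, by
    rw [tsupport_eq_empty_iff.2 rfl]; exact empty_subset _⟩

/-- The classes in `L²(I)` of the test functions on `I`. -/
def testL (a : ℝ) : Submodule ℝ (L2I a) where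
  carrier := {v | ∃ χ, IsTest (Ioo (-a) a) χ ∧ v =ᵐ[muI a] χ}
  zero_mem' := ⟨0, isTest_zero _, Lp.coeFn_zero _ _ _⟩
  add_mem' := by
    rintro u v ⟨χ, hχ, hu⟩ ⟨ψ, hψ, hv⟩
    refine ⟨fun x => χ x - (-1) * ψ x, hχ.sub (hψ.const_mul _), ?_⟩
    filter_upwards [Lp.coeFn_add u v, hu, hv] with x h1 h2 h3
    rw [h1, Pi.add_apply, h2, h3]; ring
  smul_mem' := by
    rintro c v ⟨ψ, hψ, hv⟩
    refine ⟨fun x => c * ψ x, hψ.const_mul _, ?_⟩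
    filter_upwards [Lp.coeFn_smul c v, hv] with x h1 h3
    rw [h1, Pi.smul_apply, h3, smul_eq_mul]

/-- A function orthogonal to all test functions vanishes almost everywhere by the fundamental lemma
of the calculus of variations. -/
theorem testL_topologicalClosure (a : ℝ) : (testL a).topologicalClosure = ⊤ := by
  rw [Submodule.topologicalClosure_eq_top_iff, Submodule.eq_bot_iff]
  intro u hu
  have hint : IntegrableOn u (Ioo (-a) a) := (Lp.memLp u).integrable one_le_two
  have h : ∀ᵐ x, x ∈ Ioo (-a) a → u x = 0 := by
    refine isOpen_Ioo.ae_eq_zero_of_integral_contDiff_smul_eq_zero hint.locallyIntegrableOn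
      fun χ h1 h2 h3 => ?_
    have hχ : IsTest (Ioo (-a) a) χ := ⟨h1, h2, h3⟩
    have h4 := hu _ (show (hχ.memLp (a := a)).toLp χ ∈ testL a from ⟨χ, hχ, MemLp.coeFn_toLp _⟩)
    rw [inner_L2I] at h4
    simp only [smul_eq_mul]
    rw [← hχ.setIntegral_mul, ← h4]
    refine integral_congr_ae ?_
    filter_upwards [(hχ.memLp (a := a)).coeFn_toLp] with x hx
    rw [hx]
  rw [Lp.eq_zero_iff_ae_eq_zero]
  exact (ae_restrict_iff' measurableSet_Ioo).2 h

theorem coeFn_oscL_true_zero (a : ℝ) : oscL a true 0 =ᵐ[muI a] fun _ => 1 := by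
  filter_upwards [coeFn_oscL a true 0] with x hx
  rw [hx]; simp [osc]

theorem integral_eq_inner_one (u : L2I a) :
    ∫ x in Ioo (-a) a, u x = inner ℝ u (oscL a true 0) := by
  rw [inner_L2I]
  refine integral_congr_ae ?_
  filter_upwards [coeFn_oscL_true_zero a] with x hx
  rw [hx, mul_one]

theorem abs_integral_le_norm (u : L2I a) :
    |∫ x in Ioo (-a) a, u x| ≤ ‖u‖ * ‖oscL a true 0‖ := by
  rw [integral_eq_inner_one]
  exact abs_real_inner_le_norm _ _

theorem integral_abs_le_norm (u : L2I a) :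
    ∫ x in Ioo (-a) a, |u x| ≤ ‖u‖ * ‖oscL a true 0‖ := by
  have h := abs_integral_le_norm |u|
  rw [norm_abs_eq_norm, integral_congr_ae (Lp.coeFn_abs u)] at h
  exact (le_abs_self _).trans h

/-- The primitive vanishing at the left end of a function of mean zero is in `H¹₀(I)`. -/
theorem toLp_mem_H10_of_primitive (ha : 0 < a) {w h : L2I a}
    (hw : ∀ᵐ x ∂(muI a), w x = ∫ t in (-a)..x, h t) (h0 : ∫ x in Ioo (-a) a, h x = 0) :
    WithLp.toLp 2 (w, h) ∈ H10 a := by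
  obtain ⟨η, hη, hη1⟩ := exists_isTest_integral_eq_one (s := Ioo (-a) a) isOpen_Ioo
    ⟨0, by simp [ha]⟩
  set e : L2I a := oscL a true 0
  set E : L2I a := (hη.memLp (a := a)).toLp η
  set N : ℝ := 1 + ‖e‖ * ‖E‖
  have hN : 0 < N := by positivity
  refine Metric.mem_closure_iff.2 fun ε hε => ?_
  have hdense : h ∈ (testL a).topologicalClosure := by rw [testL_topologicalClosure]; trivial
  -- The tolerance anticipates the losses below: a factor `N` from correcting the mean, and `1 + ‖e‖
  -- * ‖e‖` from adding the errors of the primitive and of the derivative.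
  obtain ⟨v, ⟨χ, hχ, hv⟩, hd⟩ := Metric.mem_closure_iff.1 hdense
    (ε / (N * (1 + ‖e‖ * ‖e‖))) (by positivity)
  have hχη : IsTest (Ioo (-a) a) fun t => χ t - (∫ t, χ t) * η t := hχ.sub (hη.const_mul _)
  obtain ⟨ψ, hψ, hψd⟩ := hχη.exists_antideriv ordConnected_Ioo (by
    rw [integral_sub hχ.integrable (hη.integrable.const_mul _), integral_const_mul, hη1]; ring)
  set P : L2I a := (hψ.memLp (a := a)).toLp ψ
  set D : L2I a := (hψ.deriv_memLp (a := a)).toLp (deriv ψ)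
  have hP : P =ᵐ[muI a] ψ := MemLp.coeFn_toLp _
  have hD : D =ᵐ[muI a] deriv ψ := MemLp.coeFn_toLp _
  refine ⟨WithLp.toLp 2 (P, D), Submodule.subset_span ⟨ψ, hψ, hP, hD⟩, ?_⟩
  have hE : E =ᵐ[muI a] η := MemLp.coeFn_toLp _
  have hint : ∀ u : L2I a, IntegrableOn u (Ioo (-a) a) := fun u =>
    (Lp.memLp u).integrable one_le_two
  -- Since `h` has mean zero, the mean to be corrected is that of `v - h`, hence small.
  have hmean : ∫ t, χ t = ∫ x in Ioo (-a) a, (v - h) x := by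
    rw [integral_congr_ae (Lp.coeFn_sub v h)]
    simp only [Pi.sub_apply]
    rw [integral_sub (hint v) (hint h), h0, sub_zero, integral_congr_ae hv]
    exact (setIntegral_eq_integral_of_forall_compl_eq_zero fun t ht =>
      hχ.eq_zero_of_notMem ht).symm
  have hDh : D - h = (v - h) - (∫ t, χ t) • E := by
    refine Lp.ext ?_
    filter_upwards [Lp.coeFn_sub D h, Lp.coeFn_sub (v - h) ((∫ t, χ t) • E), Lp.coeFn_sub v h,
      Lp.coeFn_smul (∫ t, χ t) E, hD, hE, hv] with x h1 h2 h3 h4 h5 h6 h7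
    rw [h1, h2, Pi.sub_apply, Pi.sub_apply, h3, h4, Pi.sub_apply, Pi.smul_apply, h5, h6, h7, hψd,
      smul_eq_mul]
    ring
  have hnD : ‖D - h‖ ≤ N * ‖v - h‖ := by
    rw [hDh]
    refine (norm_sub_le _ _).trans ?_
    rw [norm_smul, Real.norm_eq_abs]
    have h1 := abs_integral_le_norm (v - h)
    rw [← hmean] at h1
    have h2 := mul_le_mul_of_nonneg_right h1 (norm_nonneg E)
    simp only [N]
    nlinarith
  -- One factor `‖e‖` bounds the `L¹` norm of `D - h` by its `L²` norm; the other is the `L²` norm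
  -- of the constant `1`.
  have hnP : ‖P - w‖ ≤ ‖D - h‖ * ‖e‖ * ‖e‖ := by
    refine Lp.norm_le_mul_norm_of_ae_le_mul ?_
    filter_upwards [Lp.coeFn_sub P w, hP, hw, coeFn_oscL_true_zero a,
      ae_restrict_mem measurableSet_Ioo] with x h1 h2 h3 h4 hx
    rw [h1, Pi.sub_apply, h2, h3, h4, norm_one, mul_one]
    have hsub : Ioc (-a) x ⊆ Ioo (-a) a := fun t ht => ⟨ht.1, ht.2.trans_lt hx.2⟩
    have e1 : ψ x = ∫ t in (-a)..x, deriv ψ t := by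
      rw [intervalIntegral.integral_deriv_eq_sub (fun t _ => (hψ.hasDerivAt t).differentiableAt)
        (hψ.deriv_continuous.intervalIntegrable _ _), hψ.eq_zero_of_notMem (t := -a) (by simp),
        sub_zero]
    have i1 : IntervalIntegrable h volume (-a) x :=
      (intervalIntegrable_iff_integrableOn_Ioc_of_le hx.1.le).2 ((hint h).mono_set hsub)
    rw [e1, ← intervalIntegral.integral_sub (hψ.deriv_continuous.intervalIntegrable _ _) i1]
    refine (intervalIntegral.norm_integral_le_integral_norm hx.1.le).trans ?_
    rw [intervalIntegral.integral_of_le hx.1.le]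
    have i2 : IntegrableOn (fun t => ‖deriv ψ t - h t‖) (Ioo (-a) a) :=
      ((integrableOn_of_continuous hψ.deriv_continuous).sub (hint h)).norm
    refine (setIntegral_mono_set i2 (Eventually.of_forall fun t => norm_nonneg _)
      hsub.eventuallyLE).trans ?_
    refine le_trans (le_of_eq (integral_congr_ae ?_)) (integral_abs_le_norm (D - h))
    filter_upwards [Lp.coeFn_sub D h, hD] with t h5 h6
    rw [h5, Pi.sub_apply, h6, Real.norm_eq_abs]
  rw [dist_comm, WithLp.prod_dist_eq_of_L2]
  simp only [dist_eq_norm]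
  have hvh : N * (1 + ‖e‖ * ‖e‖) * ‖v - h‖ < ε := by
    rw [dist_comm, dist_eq_norm, lt_div_iff₀ (by positivity)] at hd
    linarith
  refine lt_of_le_of_lt (Real.sqrt_le_iff.2 ⟨by positivity, ?_⟩)
    (lt_of_le_of_lt (b := ‖P - w‖ + ‖D - h‖) le_rfl ?_)
  · change ‖P - w‖ ^ 2 + ‖D - h‖ ^ 2 ≤ _
    nlinarith [mul_nonneg (norm_nonneg (P - w)) (norm_nonneg (D - h))]
  · have h1 : ‖D - h‖ * (1 + ‖e‖ * ‖e‖) ≤ N * ‖v - h‖ * (1 + ‖e‖ * ‖e‖) := by gcongr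
    nlinarith

/-- The inclusion of `H¹₀(I)` in `L²(I)`. -/
def fnL (a : ℝ) : H10 a →L[ℝ] L2I a :=
  (WithLp.fstL 2 ℝ (L2I a) (L2I a)).comp (H10 a).subtypeL

/-- The weak derivative on `H¹₀(I)`. -/
def dxL (a : ℝ) : H10 a →L[ℝ] L2I a :=
  (WithLp.sndL 2 ℝ (L2I a) (L2I a)).comp (H10 a).subtypeL

theorem fnL_apply (v : H10 a) : fnL a v = fn v := rfl

theorem dxL_apply (v : H10 a) : dxL a v = dx v := rfl

theorem norm_sq_H10 (v : H10 a) : ‖v‖ ^ 2 = ‖fn v‖ ^ 2 + ‖dx v‖ ^ 2 :=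
  WithLp.prod_norm_sq_eq_of_L2 (v : WithLp 2 (L2I a × L2I a))

/-- Integration by parts against elements of `H¹₀(I)`. -/
theorem inner_dx_eq_neg_inner_fn (ha : 0 < a) {F F' : ℝ → ℝ} {FL FL' : L2I a}
    (hF : FL =ᵐ[muI a] F) (hF' : FL' =ᵐ[muI a] F') (hc : Continuous F)
    (hd : ∀ x, x ≠ 0 → HasDerivAt F (F' x) x) (v : H10 a) :
    inner ℝ FL (dx v) = -inner ℝ FL' (fn v) := by
  set ℓ : WithLp 2 (L2I a × L2I a) →L[ℝ] ℝ :=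
    (innerSL ℝ FL).comp (WithLp.sndL 2 ℝ (L2I a) (L2I a)) +
      (innerSL ℝ FL').comp (WithLp.fstL 2 ℝ (L2I a) (L2I a)) with hℓ
  -- The kernel of a continuous functional is closed, so it suffices to treat the test functions
  -- that span a dense subspace.
  have hle : H10 a ≤ ℓ.ker := by
    refine Submodule.topologicalClosure_minimal _ (Submodule.span_le.2 ?_) ℓ.isClosed_ker
    rintro p ⟨φ, hφ, h1, h2⟩
    change inner ℝ FL p.snd + inner ℝ FL' p.fst = 0
    have hFm : MemLp F 2 (muI a) := (Lp.memLp FL).ae_eq hF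
    have hFm' : MemLp F' 2 (muI a) := (Lp.memLp FL').ae_eq hF'
    have i1 : IntegrableOn (fun x => F x * deriv φ x) (Ioo (-a) a) :=
      hFm.integrable_mul hφ.deriv_memLp
    have i2 : IntegrableOn (fun x => F' x * φ x) (Ioo (-a) a) := hFm'.integrable_mul hφ.memLp
    have e1 : inner ℝ FL p.snd = ∫ x in Ioo (-a) a, F x * deriv φ x := by
      rw [inner_L2I]
      refine integral_congr_ae ?_
      filter_upwards [hF, h2] with x h3 h4
      rw [h3, h4]
    have e2 : inner ℝ FL' p.fst = ∫ x in Ioo (-a) a, F' x * φ x := by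
      rw [inner_L2I]
      refine integral_congr_ae ?_
      filter_upwards [hF', h1] with x h3 h4
      rw [h3, h4]
    rw [e1, e2, ← integral_add i1 i2, setIntegral_Ioo_eq_intervalIntegral ha]
    have hab : -a ≤ a := by linarith
    have h := integral_eq_of_hasDerivAt_off_countable_of_le (fun x => F x * φ x)
      (fun x => F x * deriv φ x + F' x * φ x) hab (countable_singleton (0 : ℝ))
      (hc.mul hφ.1.continuous).continuousOn
      (fun x hx => by
        rw [add_comm]
        exact (hd x hx.2).mul (hφ.hasDerivAt x))
      ((intervalIntegrable_iff_integrableOn_Ioo_of_le hab).2 (i1.add i2))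
    rw [h, hφ.eq_zero_of_notMem (t := a) (by simp), hφ.eq_zero_of_notMem (t := -a) (by simp)]
    simp
  have h := hle v.2
  change inner ℝ FL (dx v) + inner ℝ FL' (fn v) = 0 at h
  linarith

/-- A continuous function vanishing at the ends, and differentiable outside `0` with derivative in
`L²(I)`, is in `H¹₀(I)`. -/
theorem toLp_mem_H10 (ha : 0 < a) {F F' : ℝ → ℝ} {FL FL' : L2I a}
    (hF : FL =ᵐ[muI a] F) (hF' : FL' =ᵐ[muI a] F') (hc : Continuous F)
    (hd : ∀ x, x ≠ 0 → HasDerivAt F (F' x) x) (hl : F (-a) = 0) (hr : F a = 0) :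
    WithLp.toLp 2 (FL, FL') ∈ H10 a := by
  have hint : IntegrableOn F' (Ioo (-a) a) := ((Lp.memLp FL').ae_eq hF').integrable one_le_two
  have key : ∀ x, -a ≤ x → x ≤ a → ∫ t in (-a)..x, FL' t = F x := by
    intro x h1 h2
    have hsub : Ioo (-a) x ⊆ Ioo (-a) a := Ioo_subset_Ioo_right h2
    rw [intervalIntegral.integral_of_le h1, integral_Ioc_eq_integral_Ioo,
      integral_congr_ae (ae_restrict_of_ae_restrict_of_subset hsub hF'),
      ← integral_Ioc_eq_integral_Ioo, ← intervalIntegral.integral_of_le h1,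
      integral_eq_of_hasDerivAt_off_countable_of_le F F' h1 (countable_singleton (0 : ℝ))
        hc.continuousOn (fun x hx => hd x hx.2)
        ((intervalIntegrable_iff_integrableOn_Ioo_of_le h1).2 (hint.mono_set hsub)), hl, sub_zero]
  refine toLp_mem_H10_of_primitive ha ?_ ?_
  · filter_upwards [hF, ae_restrict_mem measurableSet_Ioo] with x hx hm
    rw [hx, key x hm.1.le hm.2.le]
  · rw [setIntegral_Ioo_eq_intervalIntegral ha, key a (by linarith) le_rfl, hr]

end Sobolev

/-! ### Eigenfunctions: transmission, Riesz bounds, orthogonality, completeness. -/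

section Eigenfunctions

variable {a k : ℝ}

/-- The eigenfunctions: `f_{n+1}` at `(n, true)` and `g_{n+1}` at `(n, false)`. -/
def eig (a k : ℝ) (i : ℕ × Bool) : ℝ → ℝ := if i.2 then f a (i.1 + 1) else g a k (i.1 + 1)

/-- The derivatives of the eigenfunctions, outside `0`. -/
def eigDeriv (a k : ℝ) (i : ℕ × Bool) (x : ℝ) : ℝ :=
  freq a i * ((if i.2 then -1 else 1 + k - A k x) * osc (!i.2) (freq a i) x)

theorem eig_eq (a k : ℝ) (i : ℕ × Bool) (x : ℝ) :
    eig a k i x = (if i.2 then 1 else 1 + k - A k x) * osc i.2 (freq a i) x := by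
  obtain ⟨n, b⟩ := i
  cases b
  · simp only [eig, g, osc, freq, A, Bool.false_eq_true, if_false]
    split_ifs <;> ring
  · simp [eig, f, osc, freq]

theorem eig_true (a k : ℝ) (n : ℕ) (x : ℝ) :
    eig a k (n, true) x = osc true (freq a (n, true)) x := by
  simp [eig_eq]

theorem eig_false (a k : ℝ) (n : ℕ) (x : ℝ) :
    eig a k (n, false) x = (1 + k - A k x) * osc false (freq a (n, false)) x := by
  simp [eig_eq]

/-- At every point one of the two factors is `k` and the other `1`. This identity removes the
discontinuous weight from `A g_n` and from the flux `A g_n'`. -/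
theorem A_mul_dual (k x : ℝ) : A k x * (1 + k - A k x) = k := by
  unfold A; split_ifs <;> ring

theorem hasDerivAt_A (k : ℝ) {x : ℝ} (hx : x ≠ 0) : HasDerivAt (A k) 0 x := by
  rcases lt_or_gt_of_ne hx with h | h
  · refine (hasDerivAt_const x k).congr_of_eventuallyEq ?_
    filter_upwards [gt_mem_nhds h] with y hy using if_pos hy
  · refine (hasDerivAt_const x (1 : ℝ)).congr_of_eventuallyEq ?_
    filter_upwards [lt_mem_nhds h] with y hy using if_neg (not_lt.2 hy.le)

theorem hasDerivAt_cos_mul (θ x : ℝ) :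
    HasDerivAt (fun x => Real.cos (θ * x)) (-(θ * Real.sin (θ * x))) x := by
  have := ((hasDerivAt_id x).const_mul θ).cos
  simp only [id, mul_one] at this
  convert this using 1
  ring

theorem hasDerivAt_sin_mul (θ x : ℝ) :
    HasDerivAt (fun x => Real.sin (θ * x)) (θ * Real.cos (θ * x)) x := by
  have := ((hasDerivAt_id x).const_mul θ).sin
  simp only [id, mul_one] at this
  convert this using 1
  ring

/-- The sine vanishes at `0`, the only point where `A` jumps. -/
theorem continuous_A_mul_sin (k θ : ℝ) : Continuous fun x => A k x * Real.sin (θ * x) := by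
  have : (fun x => A k x * Real.sin (θ * x)) =
      fun x => k * Real.sin (θ * min x 0) + Real.sin (θ * max x 0) := by
    funext x
    unfold A
    split_ifs with h
    · rw [min_eq_left h.le, max_eq_right h.le]; simp
    · rw [min_eq_right (not_lt.1 h), max_eq_left (not_lt.1 h)]; simp
  rw [this]
  fun_prop

theorem continuous_eig (a k : ℝ) (i : ℕ × Bool) : Continuous (eig a k i) := by
  have h : eig a k i = fun x => _ := funext (eig_eq a k i)
  rw [h]
  obtain ⟨n, b⟩ := i
  cases b
  · simp only [osc, Bool.false_eq_true, if_false, sub_mul]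
    exact (by fun_prop : Continuous fun x => (1 + k) * Real.sin (freq a (n, false) * x)).sub
      (continuous_A_mul_sin k _)
  · simp only [osc, if_true]
    fun_prop

theorem hasDerivAt_eig (a k : ℝ) (i : ℕ × Bool) {x : ℝ} (hx : x ≠ 0) :
    HasDerivAt (eig a k i) (eigDeriv a k i x) x := by
  have h : eig a k i = fun x => _ := funext (eig_eq a k i)
  rw [h]
  obtain ⟨n, b⟩ := i
  cases b
  · simp only [osc, Bool.false_eq_true, if_false, eigDeriv]
    refine (((hasDerivAt_A k hx).const_sub (1 + k)).fun_mul
      (hasDerivAt_sin_mul _ x)).congr_deriv ?_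
    simp
    ring
  · simp only [osc, if_true, eigDeriv, one_mul]
    refine (hasDerivAt_cos_mul _ x).congr_deriv ?_
    simp

theorem hasDerivAt_A_mul_eigDeriv (a k : ℝ) (i : ℕ × Bool) {x : ℝ} (hx : x ≠ 0) :
    HasDerivAt (fun x => A k x * eigDeriv a k i x) (-(freq a i) ^ 2 * (A k x * eig a k i x)) x := by
  simp only [eig_eq, eigDeriv]
  obtain ⟨n, b⟩ := i
  cases b
  · have e : (fun x => A k x * (freq a (n, false) * ((if (n, false).2 = true then -1 else
        1 + k - A k x) * osc (!(n, false).2) (freq a (n, false)) x))) =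
        fun x => freq a (n, false) * k * Real.cos (freq a (n, false) * x) := by
      funext x
      simp only [Bool.false_eq_true, if_false, osc, Bool.not_false, if_true]
      linear_combination freq a (n, false) * Real.cos (freq a (n, false) * x) * A_mul_dual k x
    rw [e]
    refine ((hasDerivAt_cos_mul (freq a (n, false)) x).const_mul
      (freq a (n, false) * k)).congr_deriv ?_
    simp only [Bool.false_eq_true, if_false, osc]
    linear_combination freq a (n, false) ^ 2 * Real.sin (freq a (n, false) * x) * A_mul_dual k x
  · simp only [if_true, osc, Bool.not_true, Bool.false_eq_true, if_false]
    refine ((hasDerivAt_A k hx).fun_mul (((hasDerivAt_sin_mul (freq a (n, true)) x).const_mul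
      (-1)).const_mul (freq a (n, true)))).congr_deriv ?_
    ring

/-- The transmission condition at `0`: for `g_n` the flux is the smooth function `k μ_n cos (μ_n
x)`, and for `f_n` it contains a sine that vanishes where `A` jumps. Integration by parts then
leaves no boundary term at `0`. -/
theorem continuous_A_mul_eigDeriv (a k : ℝ) (i : ℕ × Bool) :
    Continuous fun x => A k x * eigDeriv a k i x := by
  obtain ⟨n, b⟩ := i
  cases b
  · have e : (fun x => A k x * eigDeriv a k (n, false) x) =
        fun x => freq a (n, false) * k * Real.cos (freq a (n, false) * x) := by
      funext x
      simp only [eigDeriv, Bool.false_eq_true, if_false, osc, Bool.not_false, if_true]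
      linear_combination freq a (n, false) * Real.cos (freq a (n, false) * x) * A_mul_dual k x
    rw [e]
    fun_prop
  · have e : (fun x => A k x * eigDeriv a k (n, true) x) =
        fun x => -freq a (n, true) * (A k x * Real.sin (freq a (n, true) * x)) := by
      funext x
      simp only [eigDeriv, if_true, osc, Bool.not_true, Bool.false_eq_true, if_false]
      ring
    rw [e]
    exact continuous_const.mul (continuous_A_mul_sin k _)

theorem osc_freq_right (ha : 0 < a) (i : ℕ × Bool) : osc i.2 (freq a i) a = 0 := by
  obtain ⟨n, b⟩ := i
  cases b
  · have e : freq a (n, false) * a = (n + 1 : ℕ) * Real.pi := by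
      simp only [freq, mu, Bool.false_eq_true, if_false]; field_simp
    simp only [osc, Bool.false_eq_true, if_false, e, Real.sin_nat_mul_pi]
  · simp only [osc, if_true]
    refine Real.cos_eq_zero_iff.2 ⟨n, ?_⟩
    simp only [freq, lam, if_true]
    push_cast
    field_simp
    ring

theorem eig_right (ha : 0 < a) (i : ℕ × Bool) : eig a k i a = 0 := by
  rw [eig_eq, osc_freq_right ha, mul_zero]

theorem eig_left (ha : 0 < a) (i : ℕ × Bool) : eig a k i (-a) = 0 := by
  have h := osc_freq_right ha i
  rw [eig_eq]
  refine mul_eq_zero_of_right _ ?_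
  obtain ⟨n, b⟩ := i
  cases b <;> simpa [osc] using h

/-- The eigenfunctions as elements of `L²(I)`. -/
def eigL (a k : ℝ) (i : ℕ × Bool) : L2I a := if i.2 then fL a (i.1 + 1) else gL a k (i.1 + 1)

theorem coeFn_eigL (a k : ℝ) (i : ℕ × Bool) : eigL a k i =ᵐ[muI a] eig a k i := by
  obtain ⟨n, b⟩ := i
  cases b
  · exact (memLp_g a k (n + 1)).coeFn_toLp
  · exact (memLp_f a (n + 1)).coeFn_toLp

/-- The operators `1` and multiplication by `1 + k - A`. -/
def eigOp (a k : ℝ) (b : Bool) : L2I a →L[ℝ] L2I a :=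
  if b then ContinuousLinearMap.id ℝ _ else (1 + k) • ContinuousLinearMap.id ℝ _ - AL a k

theorem coeFn_AL (a k : ℝ) (u : L2I a) : AL a k u =ᵐ[muI a] fun x => A k x * u x := coeFn_mulL u

theorem coeFn_eigOp (a k : ℝ) (b : Bool) (u : L2I a) :
    eigOp a k b u =ᵐ[muI a] fun x => (if b then 1 else 1 + k - A k x) * u x := by
  cases b
  · simp only [eigOp, Bool.false_eq_true, if_false, sub_apply,
      smul_apply, ContinuousLinearMap.id_apply]
    filter_upwards [Lp.coeFn_sub ((1 + k) • u) (AL a k u), Lp.coeFn_smul (1 + k) u, coeFn_AL a k u]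
      with x h1 h2 h3
    rw [h1, Pi.sub_apply, h2, h3, Pi.smul_apply, smul_eq_mul]
    ring
  · simp [eigOp]

theorem eigL_eq (a k : ℝ) (i : ℕ × Bool) :
    eigL a k i = eigOp a k i.2 (oscL a i.2 (freq a i)) := by
  refine Lp.ext ?_
  filter_upwards [coeFn_eigL a k i, coeFn_eigOp a k i.2 (oscL a i.2 (freq a i)),
    coeFn_oscL a i.2 (freq a i)] with x h1 h2 h3
  rw [h1, h2, h3, eig_eq]

/-- The derivatives of the eigenfunctions as elements of `L²(I)`. -/
def eigDerivL (a k : ℝ) (i : ℕ × Bool) : L2I a :=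
  freq a i • (if i.2 then -1 else 1 : ℝ) • eigOp a k i.2 (oscL a (!i.2) (freq a i))

theorem coeFn_eigDerivL (a k : ℝ) (i : ℕ × Bool) :
    eigDerivL a k i =ᵐ[muI a] eigDeriv a k i := by
  unfold eigDerivL
  filter_upwards [Lp.coeFn_smul (freq a i)
      ((if i.2 then -1 else 1 : ℝ) • eigOp a k i.2 (oscL a (!i.2) (freq a i))),
    Lp.coeFn_smul (if i.2 then -1 else 1 : ℝ) (eigOp a k i.2 (oscL a (!i.2) (freq a i))),
    coeFn_eigOp a k i.2 (oscL a (!i.2) (freq a i)), coeFn_oscL a (!i.2) (freq a i)]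
    with x h1 h2 h3 h4
  rw [h1, Pi.smul_apply, h2, Pi.smul_apply, h3, h4, smul_eq_mul, smul_eq_mul, eigDeriv]
  split_ifs <;> ring

/-- The eigenfunctions as elements of `H¹₀(I)`. -/
def eigH (ha : 0 < a) (k : ℝ) (i : ℕ × Bool) : H10 a :=
  ⟨WithLp.toLp 2 (eigL a k i, eigDerivL a k i),
    toLp_mem_H10 ha (coeFn_eigL a k i) (coeFn_eigDerivL a k i) (continuous_eig a k i)
      (fun _ hx => hasDerivAt_eig a k i hx) (eig_left ha i) (eig_right ha i)⟩

theorem fn_eigH (ha : 0 < a) (i : ℕ × Bool) : fn (eigH ha k i) = eigL a k i := rfl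

theorem dx_eigH (ha : 0 < a) (i : ℕ × Bool) : dx (eigH ha k i) = eigDerivL a k i := rfl

/-- The eigenvalue equation, in weak form. -/
theorem inner_A_eigDerivL (ha : 0 < a) (i : ℕ × Bool) (v : H10 a) :
    inner ℝ (AL a k (eigDerivL a k i)) (dx v) =
      freq a i ^ 2 * inner ℝ (AL a k (eigL a k i)) (fn v) := by
  have h := inner_dx_eq_neg_inner_fn ha (FL := AL a k (eigDerivL a k i))
    (FL' := (-(freq a i) ^ 2) • AL a k (eigL a k i))
    (F := fun x => A k x * eigDeriv a k i x)
    (F' := fun x => -(freq a i) ^ 2 * (A k x * eig a k i x))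
    (by
      filter_upwards [coeFn_AL a k (eigDerivL a k i), coeFn_eigDerivL a k i] with x h1 h2
      rw [h1, h2])
    (by
      filter_upwards [Lp.coeFn_smul (-(freq a i) ^ 2) (AL a k (eigL a k i)),
        coeFn_AL a k (eigL a k i), coeFn_eigL a k i] with x h1 h2 h3
      rw [h1, Pi.smul_apply, h2, h3, smul_eq_mul])
    (continuous_A_mul_eigDeriv a k i) (fun x hx => hasDerivAt_A_mul_eigDeriv a k i hx) v
  rw [h, inner_smul_left, conj_trivial]
  ring

theorem exists_besselBound_eigL (ha : 0 < a) (k : ℝ) :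
    ∃ K, BesselBound (eigL a k) (fun _ => 1) K := by
  obtain ⟨K, h⟩ : ∃ K, BesselBound (fun i : ℕ × Bool => (√a * 1) • eigOp a k i.2
      ((√a)⁻¹ • oscL a (false ^^ i.2) (freq a i))) (fun _ => (1 : ℝ) ^ 2) K :=
    ⟨_, besselBound_of_orthonormal (orthonormal_oscL ha false) (fun i => i.2) (eigOp a k) (√a)
      fun _ => 1⟩
  have hs : √a ≠ 0 := (Real.sqrt_pos.2 ha).ne'
  refine ⟨K, ?_⟩
  convert h using 1
  · funext i
    rw [map_smul, smul_smul, mul_one, mul_inv_cancel₀ hs, one_smul, Bool.false_xor, eigL_eq]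
  · funext i; simp

/-- Differentiation exchanges cosines and sines, so the orthonormal family with flag `true` is used,
and each derivative carries its frequency as a factor. -/
theorem exists_besselBound_eigDerivL (ha : 0 < a) (k : ℝ) :
    ∃ K, BesselBound (eigDerivL a k) (fun i => freq a i ^ 2) K := by
  obtain ⟨K, h⟩ : ∃ K, BesselBound (fun i : ℕ × Bool => (√a * freq a i) •
      ((if i.2 then -1 else 1 : ℝ) • eigOp a k i.2) ((√a)⁻¹ • oscL a (true ^^ i.2) (freq a i)))
      (fun i => freq a i ^ 2) K :=
    ⟨_, besselBound_of_orthonormal (orthonormal_oscL ha true) (fun i => i.2)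
      (fun b => (if b then -1 else 1 : ℝ) • eigOp a k b) (√a) (freq a)⟩
  have hs : √a ≠ 0 := (Real.sqrt_pos.2 ha).ne'
  refine ⟨K, ?_⟩
  convert h using 1
  funext i
  rw [map_smul, smul_smul, mul_right_comm, mul_inv_cancel₀ hs, one_mul, Bool.true_xor, eigDerivL,
    smul_apply]

theorem exists_besselBound_eigH (ha : 0 < a) (k : ℝ) :
    ∃ K, BesselBound (eigH ha k) (fun i => 1 + freq a i ^ 2) K := by
  obtain ⟨K₁, h₁⟩ := exists_besselBound_eigL ha k
  obtain ⟨K₂, h₂⟩ := exists_besselBound_eigDerivL ha k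
  refine ⟨K₁ + K₂, add_nonneg h₁.1 h₂.1, fun i => by positivity, fun s c => ?_⟩
  have e1 : fn (∑ i ∈ s, c i • eigH ha k i) = ∑ i ∈ s, c i • eigL a k i := by
    rw [← fnL_apply, map_sum]; simp only [map_smul, fnL_apply, fn_eigH]
  have e2 : dx (∑ i ∈ s, c i • eigH ha k i) = ∑ i ∈ s, c i • eigDerivL a k i := by
    rw [← dxL_apply, map_sum]; simp only [map_smul, dxL_apply, dx_eigH]
  rw [norm_sq_H10, e1, e2]
  have b1 := h₁.2.2 s c
  have b2 := h₂.2.2 s c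
  simp only [one_mul] at b1
  simp only [add_mul, one_mul, Finset.sum_add_distrib]
  have p1 : 0 ≤ ∑ i ∈ s, c i ^ 2 := Finset.sum_nonneg fun i _ => sq_nonneg _
  have p2 : 0 ≤ ∑ i ∈ s, freq a i ^ 2 * c i ^ 2 := Finset.sum_nonneg fun i _ => by positivity
  have := mul_nonneg h₁.1 p2
  have := mul_nonneg h₂.1 p1
  linarith

/-- The values of `∫_I A |f_n|²` and `∫_I A |g_n|²`. -/
def eigNorm (a k : ℝ) (b : Bool) : ℝ := a * (k + 1) / 2 * if b then 1 else k

theorem eigNorm_ne_zero (ha : 0 < a) (hk0 : k ≠ 0) (hk1 : k ≠ -1) (b : Bool) :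
    eigNorm a k b ≠ 0 := by
  have h1 : k + 1 ≠ 0 := fun h => hk1 (by linarith)
  unfold eigNorm
  have := ha.ne'
  cases b <;> simp [*]

/-- `A (1 + k - A) = k` turns a mixed product into `k` times a product of opposite parities, and
turns the weight of two sines into `k (1 + k - A)`. What remains involves `A` only against even
functions, where it acts as `(k + 1) / 2`. -/
theorem integral_A_eig_mul_eig (ha : 0 < a) (i j : ℕ × Bool) :
    ∫ x in Ioo (-a) a, A k x * eig a k i x * eig a k j x =
      if i = j then eigNorm a k i.2 else 0 := by
  have hint : IntegrableOn (fun x => osc i.2 (freq a i) x * osc j.2 (freq a j) x) (Ioo (-a) a) :=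
    integrableOn_of_continuous ((continuous_osc _ _).mul (continuous_osc _ _))
  have hO := integral_osc_freq ha false i j
  simp only [Bool.false_xor] at hO
  have hA : i.2 = j.2 → ∫ x in Ioo (-a) a, A k x * (osc i.2 (freq a i) x * osc j.2 (freq a j) x) =
      (k + 1) / 2 * if i = j then a else 0 := by
    intro hij
    rw [integral_A_mul_of_even hint (Eventually.of_forall fun x => ?_), hO]
    rw [hij]
    cases j.2 <;> simp [osc]
  obtain ⟨n, b⟩ := i
  obtain ⟨m, c⟩ := j
  dsimp only at hint hO hA
  cases b <;> cases c
  · have e : ∀ x, A k x * eig a k (n, false) x * eig a k (m, false) x =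
        k * (1 + k) * (osc false (freq a (n, false)) x * osc false (freq a (m, false)) x) -
        k * (A k x * (osc false (freq a (n, false)) x * osc false (freq a (m, false)) x)) := by
      intro x
      rw [eig_false, eig_false]
      linear_combination (1 + k - A k x) *
        (osc false (freq a (n, false)) x * osc false (freq a (m, false)) x) * A_mul_dual k x
    simp only [e]
    rw [integral_sub (hint.const_mul _) ((integrable_A_mul hint).const_mul _), integral_const_mul,
      integral_const_mul, hO, hA rfl]
    simp only [eigNorm]
    split_ifs <;> first | contradiction | ring
  · have e : ∀ x, A k x * eig a k (n, false) x * eig a k (m, true) x =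
        k * (osc false (freq a (n, false)) x * osc true (freq a (m, true)) x) := by
      intro x
      rw [eig_false, eig_true]
      linear_combination (osc false (freq a (n, false)) x * osc true (freq a (m, true)) x) *
        A_mul_dual k x
    simp only [e]
    rw [integral_const_mul, hO]
    simp
  · have e : ∀ x, A k x * eig a k (n, true) x * eig a k (m, false) x =
        k * (osc true (freq a (n, true)) x * osc false (freq a (m, false)) x) := by
      intro x
      rw [eig_true, eig_false]
      linear_combination (osc true (freq a (n, true)) x * osc false (freq a (m, false)) x) *
        A_mul_dual k x
    simp only [e]
    rw [integral_const_mul, hO]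
    simp
  · have e : ∀ x, A k x * eig a k (n, true) x * eig a k (m, true) x =
        A k x * (osc true (freq a (n, true)) x * osc true (freq a (m, true)) x) := by
      intro x
      rw [eig_true, eig_true]
      ring
    simp only [e]
    rw [hA rfl]
    simp only [eigNorm]
    split_ifs <;> first | contradiction | ring

theorem inner_A_eigL (ha : 0 < a) (i j : ℕ × Bool) :
    inner ℝ (AL a k (eigL a k i)) (eigL a k j) = if i = j then eigNorm a k i.2 else 0 := by
  rw [inner_AL, ← integral_A_eig_mul_eig ha]
  refine integral_congr_ae ?_
  filter_upwards [coeFn_eigL a k i, coeFn_eigL a k j] with x h1 h2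
  rw [h1, h2]

/-- The eigenfunctions are complete. -/
theorem eq_zero_of_inner_A_eigL_eq_zero (ha : 0 < a) (hk0 : k ≠ 0) (hk1 : k ≠ -1) {u : L2I a}
    (h : ∀ i, inner ℝ (AL a k (eigL a k i)) u = 0) : u = 0 := by
  have h' : ∀ i, ∫ x in Ioo (-a) a, A k x * eig a k i x * u x = 0 := by
    intro i
    rw [← h i, inner_AL]
    refine integral_congr_ae ?_
    filter_upwards [coeFn_eigL a k i] with x h1
    rw [h1]
  have hu := Lp.memLp u
  have heven : ∀ᵐ x ∂(muI a), u (-x) = u x := by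
    -- Here `A g_n = k sin (μ_n x)`, so `k ≠ 0` yields vanishing sine coefficients.
    refine ae_even_of_integral_sin_eq_zero ha hu fun n => ?_
    have h1 := h' (n, false)
    have e : ∀ x, A k x * eig a k (n, false) x * u x =
        k * (u x * Real.sin (mu a (n + 1) * x)) := by
      intro x
      rw [eig_eq]
      simp only [osc, freq, Bool.false_eq_true, if_false]
      linear_combination u x * Real.sin (mu a (n + 1) * x) * A_mul_dual k x
    simp only [e] at h1
    rw [integral_const_mul] at h1
    exact (mul_eq_zero.1 h1).resolve_left hk0
  rw [Lp.eq_zero_iff_ae_eq_zero]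
  refine ae_eq_zero_of_even_of_integral_cos_eq_zero ha hu heven fun n => ?_
  have h1 := h' (n, true)
  have e : ∀ x, A k x * eig a k (n, true) x * u x =
      A k x * (u x * Real.cos (lam a (n + 1) * x)) := by
    intro x
    rw [eig_eq]
    simp only [osc, freq, if_true]
    ring
  simp only [e] at h1
  have hi : IntegrableOn (fun x => u x * Real.cos (lam a (n + 1) * x)) (Ioo (-a) a) :=
    hu.integrable_mul (memLp_f a (n + 1))
  -- Evenness of `u` replaces the weight by `(k + 1) / 2`, which is nonzero since `k ≠ -1`.
  rw [integral_A_mul_of_even hi] at h1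
  · refine (mul_eq_zero.1 h1).resolve_left fun h2 => hk1 (by linarith)
  · filter_upwards [heven] with x hx
    rw [hx, mul_neg, Real.cos_neg]

end Eigenfunctions

/-! ### Existence and uniqueness of the weak solution. -/

section WeakSolution

variable {a k : ℝ}

/-- The coefficient of `u` along an eigenfunction. -/
def coef (a k : ℝ) (u : L2I a) (i : ℕ × Bool) : ℝ :=
  inner ℝ (AL a k (eigL a k i)) u / eigNorm a k i.2

theorem inner_AL_comm (k : ℝ) (u v : L2I a) :
    inner ℝ (AL a k u) v = inner ℝ (AL a k v) u := by
  rw [inner_AL, inner_AL]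
  congr 1; ext x; ring

/-- The functional `u ↦ ∫_I A u w`. -/
def pairA (k : ℝ) (w : L2I a) : L2I a →L[ℝ] ℝ := innerSL ℝ (AL a k w)

theorem pairA_apply (k : ℝ) (w u : L2I a) : pairA k w u = inner ℝ (AL a k u) w := by
  rw [inner_AL_comm]; rfl

/-- The form is symmetric, so the numerators are plain inner products of `AL a k u` with the
eigenfunctions; the dual Bessel inequality applies to that vector. -/
theorem summable_coef_sq (ha : 0 < a) (k : ℝ) (u : L2I a) :
    Summable fun i => coef a k u i ^ 2 := by
  obtain ⟨K, hK⟩ := exists_besselBound_eigL ha k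
  have h := hK.summable_inner_sq (AL a k u)
  refine Summable.of_nonneg_of_le (fun i => sq_nonneg _) (fun i => ?_)
    (h.mul_left ((eigNorm a k true)⁻¹ ^ 2 + (eigNorm a k false)⁻¹ ^ 2))
  rw [coef, inner_AL_comm, real_inner_comm, div_eq_mul_inv, mul_pow, mul_comm]
  refine mul_le_mul_of_nonneg_right ?_ (sq_nonneg _)
  cases i.2
  · exact le_add_of_nonneg_left (sq_nonneg _)
  · exact le_add_of_nonneg_right (sq_nonneg _)

/-- The series of the solution, in `L²(I)`. -/
def sol (a k : ℝ) (u₀ : L2I a) (t : ℝ) : L2I a :=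
  ∑' i, (coef a k u₀ i * Real.exp (-(freq a i) ^ 2 * t / 2)) • eigL a k i

/-- The series of the solution, in `H¹₀(I)`. -/
def solH (ha : 0 < a) (k : ℝ) (u₀ : L2I a) (t : ℝ) : H10 a :=
  ∑' i, (coef a k u₀ i * Real.exp (-(freq a i) ^ 2 * t / 2)) • eigH ha k i

theorem hasSum_sol (ha : 0 < a) (u₀ : L2I a) {t : ℝ} (ht : 0 ≤ t) :
    HasSum (fun i => (coef a k u₀ i * Real.exp (-(freq a i) ^ 2 * t / 2)) • eigL a k i)
      (sol a k u₀ t) := by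
  obtain ⟨K, hK⟩ := exists_besselBound_eigL ha k
  exact (hK.summable (summable_heat_sq (summable_coef_sq ha k u₀) ht)).hasSum

theorem hasSum_solH (ha : 0 < a) (u₀ : L2I a) {t : ℝ} (ht : 0 < t) :
    HasSum (fun i => (coef a k u₀ i * Real.exp (-(freq a i) ^ 2 * t / 2)) • eigH ha k i)
      (solH ha k u₀ t) := by
  obtain ⟨K, hK⟩ := exists_besselBound_eigH ha k
  exact (hK.summable (summable_heat_weight_sq (summable_coef_sq ha k u₀) ht)).hasSum

theorem fn_solH (ha : 0 < a) (u₀ : L2I a) {t : ℝ} (ht : 0 < t) :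
    fn (solH ha k u₀ t) = sol a k u₀ t := by
  have h := (hasSum_solH (k := k) ha u₀ ht).mapL (fnL a)
  simp only [map_smul, fnL_apply, fn_eigH] at h
  exact h.unique (hasSum_sol ha u₀ ht.le)

theorem continuousOn_sol (ha : 0 < a) (u₀ : L2I a) : ContinuousOn (sol a k u₀) (Ici 0) := by
  obtain ⟨K, hK⟩ := exists_besselBound_eigL ha k
  exact continuousOn_heat_series hK (summable_coef_sq ha k u₀)

theorem memLp_solH (ha : 0 < a) (u₀ : L2I a) :
    MemLp (solH ha k u₀) 2 (volume.restrict (Ioi (0 : ℝ))) := by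
  obtain ⟨K, hK⟩ := exists_besselBound_eigH ha k
  have hρ : 0 < Real.pi / (2 * a) := by have := Real.pi_pos; positivity
  refine memLp_heat_series hK (summable_coef_sq ha k u₀) (pow_pos hρ 2) fun i => ?_
  have h := freq_lower_bound ha i
  refine pow_le_pow_left₀ hρ.le (le_trans ?_ h) 2
  exact le_mul_of_one_le_left hρ.le (by have := i.1.cast_nonneg (α := ℝ); linarith)

theorem inner_A_eigL_sol (ha : 0 < a) (hk0 : k ≠ 0) (hk1 : k ≠ -1) (u₀ : L2I a) {t : ℝ}
    (ht : 0 ≤ t) (i : ℕ × Bool) : inner ℝ (AL a k (eigL a k i)) (sol a k u₀ t) =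
      inner ℝ (AL a k (eigL a k i)) u₀ * Real.exp (-(freq a i) ^ 2 * t / 2) := by
  have h := (hasSum_sol (k := k) ha u₀ ht).mapL (innerSL ℝ (AL a k (eigL a k i)))
  simp only [map_smul, innerSL_apply_apply, inner_A_eigL ha, smul_eq_mul, mul_ite, mul_zero] at h
  rw [h.unique (hasSum_single i fun j hj => by rw [if_neg (Ne.symm hj)]), if_pos rfl, coef]
  have := eigNorm_ne_zero ha hk0 hk1 i.2
  field_simp

theorem eq_of_inner_A_eigL_eq (ha : 0 < a) (hk0 : k ≠ 0) (hk1 : k ≠ -1) {u v : L2I a}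
    (h : ∀ i, inner ℝ (AL a k (eigL a k i)) u = inner ℝ (AL a k (eigL a k i)) v) : u = v :=
  sub_eq_zero.1 (eq_zero_of_inner_A_eigL_eq_zero ha hk0 hk1 fun i => by
    rw [inner_sub_right, h, sub_self])

theorem sol_zero (ha : 0 < a) (hk0 : k ≠ 0) (hk1 : k ≠ -1) (u₀ : L2I a) : sol a k u₀ 0 = u₀ :=
  eq_of_inner_A_eigL_eq ha hk0 hk1 fun i => by
    rw [inner_A_eigL_sol ha hk0 hk1 u₀ le_rfl]; simp

/-- The functional `v ↦ -½ ∫_I A U' v'` on `H¹₀(I)`. -/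
def halfDiv (k : ℝ) (U : H10 a) : Hm1 a :=
  (innerSL ℝ ((-(1 / 2) : ℝ) • AL a k (dx U))).comp (dxL a)

theorem halfDiv_apply (U v : H10 a) :
    halfDiv k U v = -(1 / 2) * inner ℝ (AL a k (dx U)) (dx v) :=
  real_inner_smul_left (AL a k (dx U)) (dx v) _

theorem dist_halfDiv_le (k : ℝ) (U V : H10 a) : dist (halfDiv k U) (halfDiv k V) ≤
    ‖(AL a k).comp (dxL a)‖ * ‖dxL a‖ * dist U V := by
  rw [dist_eq_norm U V, dist_eq_norm (halfDiv k U) (halfDiv k V)]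
  refine ContinuousLinearMap.opNorm_le_bound _ (by positivity) fun v => ?_
  have e : (halfDiv k U - halfDiv k V) v =
      -(1 / 2) * inner ℝ (((AL a k).comp (dxL a)) (U - V)) (dxL a v) := by
    rw [map_sub, inner_sub_left, mul_sub]
    exact congrArg₂ (· - ·) (halfDiv_apply U v) (halfDiv_apply V v)
  rw [e, norm_mul, Real.norm_eq_abs, Real.norm_eq_abs, show |(-(1 / 2) : ℝ)| = 1 / 2 by norm_num]
  have h1 := abs_real_inner_le_norm (((AL a k).comp (dxL a)) (U - V)) (dxL a v)
  have h4 := mul_le_mul (((AL a k).comp (dxL a)).le_opNorm (U - V)) ((dxL a).le_opNorm v)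
    (norm_nonneg _) (by positivity)
  have h5 := abs_nonneg (inner ℝ (((AL a k).comp (dxL a)) (U - V)) (dxL a v))
  linarith

/-- The functional `U ↦ -½ ∫_I A U' v'` on `H¹₀(I)`. -/
def halfDivAt (k : ℝ) (v : H10 a) : H10 a →L[ℝ] ℝ :=
  (innerSL ℝ ((-(1 / 2) : ℝ) • AL a k (dx v))).comp (dxL a)

theorem halfDivAt_apply (U v : H10 a) : halfDivAt k v U = halfDiv k U v := by
  rw [halfDiv_apply, inner_AL_comm]
  exact real_inner_smul_left (AL a k (dx v)) (dx U) _

/-- For fixed `v` the functional is continuous in `U`, and the weak eigenvalue equation turns each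
term into the time derivative of the corresponding term of `∫ A u v`. -/
theorem hasSum_halfDiv_solH (ha : 0 < a) (u₀ : L2I a) (v : H10 a) {t : ℝ} (ht : 0 < t) :
    HasSum (fun i => -(freq a i) ^ 2 / 2 * Real.exp (-(freq a i) ^ 2 * t / 2) *
      (coef a k u₀ i * inner ℝ (AL a k (eigL a k i)) (fn v))) (halfDiv k (solH ha k u₀ t) v) := by
  have h := (hasSum_solH (k := k) ha u₀ ht).mapL (halfDivAt k v)
  simp only [map_smul, halfDivAt_apply, halfDiv_apply, dx_eigH,
    inner_A_eigDerivL ha, smul_eq_mul] at h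
  rw [halfDiv_apply]
  refine Eq.subst (motive := fun F => HasSum F _) (funext fun i => ?_) h
  ring

theorem hasDerivAt_inner_A_sol (ha : 0 < a) (u₀ : L2I a) (v : H10 a) {t : ℝ} (ht : 0 < t) :
    HasDerivAt (fun t => inner ℝ (AL a k (sol a k u₀ t)) (fn v))
      (halfDiv k (solH ha k u₀ t) v) t := by
  have hpair : ∀ {s : ℝ}, 0 ≤ s → HasSum (fun i => Real.exp (-(freq a i) ^ 2 * s / 2) *
      (coef a k u₀ i * inner ℝ (AL a k (eigL a k i)) (fn v)))
      (inner ℝ (AL a k (sol a k u₀ s)) (fn v)) := by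
    intro s hs
    have h := (hasSum_sol (k := k) ha u₀ hs).mapL (pairA k (fn v))
    simp only [map_smul, pairA_apply, smul_eq_mul] at h
    refine Eq.subst (motive := fun F => HasSum F _) (funext fun i => ?_) h
    ring
  -- At time `0` all exponentials are `1`, so convergence of the series of the initial value, paired
  -- with `v`, is the required summability.
  have hq : Summable fun i => coef a k u₀ i * inner ℝ (AL a k (eigL a k i)) (fn v) := by
    simpa using (hpair le_rfl).summable
  have h := hasDerivAt_heat_series (ν := freq a) hq ht
  rw [(hasSum_halfDiv_solH ha u₀ v ht).tsum_eq] at h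
  refine h.congr_of_eventuallyEq ?_
  filter_upwards [lt_mem_nhds ht] with s hs
  exact (hpair hs.le).tsum_eq.symm

theorem memLp_halfDiv_solH (ha : 0 < a) (u₀ : L2I a) :
    MemLp (fun t => halfDiv k (solH ha k u₀ t)) 2 (volume.restrict (Ioi (0 : ℝ))) := by
  have hcont : Continuous (halfDiv (a := a) k) :=
    (LipschitzWith.of_dist_le_mul (K := ⟨‖(AL a k).comp (dxL a)‖ * ‖dxL a‖, by positivity⟩)
      (dist_halfDiv_le k)).continuous
  have hzero : halfDiv (a := a) k 0 = 0 := by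
    ext v
    rw [← halfDivAt_apply, map_zero]
    rfl
  have hmeas : AEStronglyMeasurable (fun t => halfDiv k (solH ha k u₀ t))
      (volume.restrict (Ioi (0 : ℝ))) :=
    hcont.comp_aestronglyMeasurable (memLp_solH ha u₀).1
  refine MemLp.of_le_mul (f := fun t => halfDiv k (solH ha k u₀ t)) (g := solH ha k u₀)
    (c := ‖(AL a k).comp (dxL a)‖ * ‖dxL a‖) (memLp_solH ha u₀) hmeas
    (Eventually.of_forall fun t => ?_)
  have h := dist_halfDiv_le k (solH ha k u₀ t) 0
  rw [hzero, dist_zero_right (solH ha k u₀ t)] at h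
  exact (dist_zero_right (halfDiv k (solH ha k u₀ t))).ge.trans h

theorem memLp_halfDiv_solH_apply (ha : 0 < a) (u₀ : L2I a) (v : H10 a) :
    MemLp (fun t => halfDiv k (solH ha k u₀ t) v) 2 (volume.restrict (Ioi (0 : ℝ))) := by
  simpa only [Function.comp_def, halfDivAt_apply] using
    (halfDivAt k v).comp_memLp' (memLp_solH (k := k) ha u₀)

theorem continuousOn_inner_A_sol (ha : 0 < a) (u₀ : L2I a) (v : H10 a) :
    ContinuousOn (fun t => inner ℝ (AL a k (sol a k u₀ t)) (fn v)) (Ici 0) := by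
  simpa only [Function.comp_def, pairA_apply] using
    (pairA k (fn v)).continuous.comp_continuousOn (continuousOn_sol (k := k) ha u₀)

theorem isWeakSolution_of_eqOn_sol (ha : 0 < a) (hk0 : k ≠ 0) (hk1 : k ≠ -1) {u₀ : L2I a}
    {u : ℝ → L2I a} (hu : ∀ t, 0 ≤ t → u t = sol a k u₀ t) : IsWeakSolution a k u₀ u := by
  unfold IsWeakSolution
  simp only [← inner_AL]
  refine ⟨⟨solH ha k u₀, fun t => halfDiv k (solH ha k u₀ t), memLp_solH ha u₀, ?_,
    memLp_halfDiv_solH ha u₀, ?_, ?_⟩, fun v => ?_, ?_⟩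
  · filter_upwards [ae_restrict_mem measurableSet_Ioi] with t ht
    have ht : 0 < t := ht
    rw [fn_solH ha u₀ ht, hu t ht.le]
  · intro v φ hφ
    rw [← integral_deriv_mul_eq_neg_of_hasDerivAt hφ (continuousOn_inner_A_sol ha u₀ v)
      (fun t ht => hasDerivAt_inner_A_sol ha u₀ v ht) (memLp_halfDiv_solH_apply ha u₀ v)]
    refine setIntegral_congr_fun measurableSet_Ioi fun t ht => ?_
    simp only [hu t (le_of_lt ht)]
  · refine Eventually.of_forall fun t v => ?_
    rw [halfDiv_apply]
    ring
  · exact (continuousOn_inner_A_sol (k := k) ha u₀ v).congr fun t ht => by simp only [hu t ht]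
  · rw [hu 0 le_rfl, sol_zero ha hk0 hk1]

/-- Testing with an eigenfunction closes the equation into `m' = -(ν²/2) m`, and completeness
recovers `u t` from these pairings. No positivity of the form is involved. -/
theorem IsWeakSolution.eq_sol (ha : 0 < a) (hk0 : k ≠ 0) (hk1 : k ≠ -1) {u₀ : L2I a}
    {u : ℝ → L2I a} (hu : IsWeakSolution a k u₀ u) {t : ℝ} (ht : 0 ≤ t) :
    u t = sol a k u₀ t := by
  unfold IsWeakSolution at hu
  simp only [← inner_AL] at hu
  obtain ⟨⟨U, W, -, hU, -, hW, hE⟩, hc, h0⟩ := hu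
  refine eq_of_inner_A_eigL_eq ha hk0 hk1 fun i => ?_
  have h := eq_mul_exp_of_weak_deriv (c := freq a i ^ 2 / 2) (hc (eigH ha k i)) (fun φ hφ => by
    rw [hW (eigH ha k i) φ hφ, ← integral_neg]
    refine integral_congr_ae ?_
    filter_upwards [hU, hE] with t h1 h2
    have h3 := h2 (eigH ha k i)
    rw [dx_eigH, inner_AL_comm, inner_A_eigDerivL ha, h1, inner_AL_comm] at h3
    simp only [fn_eigH]
    linear_combination (-(1 / 2) * φ t) * h3) ht
  rw [inner_A_eigL_sol ha hk0 hk1 u₀ ht, inner_AL_comm, inner_AL_comm k _ u₀, ← h0]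
  simp only [fn_eigH] at h
  rw [h]
  congr 2
  ring

end WeakSolution

/-! ### The spectral kernel and pointwise convergence. -/

section Pointwise

variable {a k : ℝ}

theorem inner_A_eigL_eq_integral (u : L2I a) (i : ℕ × Bool) :
    inner ℝ (AL a k (eigL a k i)) u = ∫ x in Ioo (-a) a, A k x * u x * eig a k i x := by
  rw [inner_AL]
  refine integral_congr_ae ?_
  filter_upwards [coeFn_eigL a k i] with x hx
  rw [hx]; ring

theorem integral_A_mul_abs_sq (ha : 0 < a) (i : ℕ × Bool) :
    ∫ x in Ioo (-a) a, A k x * |eig a k i x| ^ 2 = eigNorm a k i.2 := by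
  have h := integral_A_eig_mul_eig (k := k) ha i i
  rw [if_pos rfl] at h
  rw [← h]
  congr 1; ext x
  rw [sq_abs]; ring

theorem coeffA_eq (ha : 0 < a) (u : L2I a) (n : ℕ) :
    coeffA a k u (n + 1) = coef a k u (n, true) := by
  rw [coef, inner_A_eigL_eq_integral, ← integral_A_mul_abs_sq ha (n, true)]
  rfl

theorem coeffB_eq (ha : 0 < a) (u : L2I a) (n : ℕ) :
    coeffB a k u (n + 1) = coef a k u (n, false) := by
  rw [coef, inner_A_eigL_eq_integral, ← integral_A_mul_abs_sq ha (n, false)]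
  rfl

/-- Unconditional convergence over all eigenfunctions allows grouping `f_n` and `g_n` of the same
index. -/
theorem hasSum_termL (ha : 0 < a) (u₀ : L2I a) {t : ℝ} (ht : 0 ≤ t) :
    HasSum (fun n : ℕ => termL a k u₀ t (n + 1)) (sol a k u₀ t) := by
  refine (hasSum_sol (k := k) ha u₀ ht).prod_fiberwise fun n => ?_
  have h := hasSum_fintype fun b : Bool =>
    (coef a k u₀ (n, b) * Real.exp (-(freq a (n, b)) ^ 2 * t / 2)) • eigL a k (n, b)
  rw [Fintype.sum_bool] at h
  rw [termL, coeffA_eq ha, coeffB_eq ha]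
  exact h

theorem spectralSol_eq_sol (ha : 0 < a) (u₀ : L2I a) {t : ℝ} (ht : 0 ≤ t) :
    spectralSol a k u₀ t = sol a k u₀ t :=
  (hasSum_termL ha u₀ ht).tsum_eq

theorem abs_eig_le (a k : ℝ) (i : ℕ × Bool) (x : ℝ) : |eig a k i x| ≤ 1 + |k| := by
  have hk := abs_nonneg k
  have ho := abs_osc_le_one i.2 (freq a i) x
  have hm : |if i.2 then 1 else 1 + k - A k x| ≤ 1 + |k| := by
    unfold A
    split_ifs
    · rw [abs_one]; linarith
    · rw [add_sub_cancel_right, abs_one]; linarith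
    · rw [add_sub_cancel_left]; linarith
  rw [eig_eq, abs_mul]
  exact (mul_le_of_le_one_right (abs_nonneg _) ho).trans hm

theorem measurable_eig (a k : ℝ) (i : ℕ × Bool) : Measurable (eig a k i) :=
  (continuous_eig a k i).measurable

/-- The ratio of a geometric series dominating the exponentials. -/
def expRatio (a t : ℝ) : ℝ := Real.exp (-(Real.pi / (2 * a)) ^ 2 * t / 2)

theorem expRatio_lt_one (ha : 0 < a) {t : ℝ} (ht : 0 < t) : expRatio a t < 1 := by
  have := Real.pi_pos
  have h : 0 < (Real.pi / (2 * a)) ^ 2 * t := by positivity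
  rw [expRatio, Real.exp_lt_one_iff]
  linarith

/-- The bound `(n + 1)² ≥ n` is enough: it weakens Gaussian decay in `n` to a geometric series. -/
theorem exp_freq_le (ha : 0 < a) {t : ℝ} (ht : 0 < t) (i : ℕ × Bool) :
    Real.exp (-(freq a i) ^ 2 * t / 2) ≤ expRatio a t ^ i.1 := by
  rw [expRatio, ← Real.exp_nat_mul, Real.exp_le_exp]
  have hρ : 0 < Real.pi / (2 * a) := by have := Real.pi_pos; positivity
  have hn := i.1.cast_nonneg (α := ℝ)
  have h1 : ((i.1 + 1 : ℝ) * (Real.pi / (2 * a))) ^ 2 ≤ freq a i ^ 2 :=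
    pow_le_pow_left₀ (by positivity) (freq_lower_bound ha i) 2
  have h2 : (i.1 : ℝ) * (Real.pi / (2 * a)) ^ 2 ≤ freq a i ^ 2 := by
    refine le_trans ?_ h1
    rw [mul_pow]
    exact mul_le_mul_of_nonneg_right (by nlinarith) (sq_nonneg _)
  have h3 := mul_le_mul_of_nonneg_right h2 ht.le
  linarith

/-- The part of the kernel given by one eigenfunction. -/
def eigKernel (a k t x y : ℝ) (i : ℕ × Bool) : ℝ :=
  A k y * ((eigNorm a k i.2)⁻¹ * eig a k i y * eig a k i x *
    Real.exp (-(freq a i) ^ 2 * t / 2))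

theorem kernelTerm_eq (t x y : ℝ) (n : ℕ) : kernelTerm a k t x y (n + 1) =
    eigKernel a k t x y (n, true) + eigKernel a k t x y (n, false) := by
  have h1 : (eigNorm a k true)⁻¹ = 2 / (a * (k + 1)) := by simp [eigNorm]
  have h2 : (eigNorm a k false)⁻¹ = 2 / (a * k * (k + 1)) := by
    rw [eigNorm, if_neg Bool.false_ne_true, div_mul_eq_mul_div, inv_div]
    congr 1; ring
  rw [kernelTerm, eigKernel, eigKernel, ← mul_add, h1, h2]
  rfl

theorem termPt_eq (ha : 0 < a) (u₀ : L2I a) (t x : ℝ) (n : ℕ) : termPt a k u₀ t x (n + 1) =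
    coef a k u₀ (n, true) * Real.exp (-(freq a (n, true)) ^ 2 * t / 2) * eig a k (n, true) x +
    coef a k u₀ (n, false) * Real.exp (-(freq a (n, false)) ^ 2 * t / 2) *
      eig a k (n, false) x := by
  rw [termPt, coeffA_eq ha, coeffB_eq ha]
  rfl

theorem abs_eigKernel_le (ha : 0 < a) {t : ℝ} (ht : 0 < t) (x y : ℝ) (i : ℕ × Bool) :
    |eigKernel a k t x y i| ≤ (1 + |k|) ^ 3 * |(eigNorm a k i.2)⁻¹| * expRatio a t ^ i.1 := by
  rw [eigKernel, abs_mul, abs_mul, abs_mul, abs_mul, Real.abs_exp]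
  calc _ ≤ (1 + |k|) * (|(eigNorm a k i.2)⁻¹| * (1 + |k|) * (1 + |k|) * expRatio a t ^ i.1) := by
        gcongr
        · exact abs_A_le k y
        · exact abs_eig_le a k i y
        · exact abs_eig_le a k i x
        · exact exp_freq_le ha ht i
    _ = _ := by ring

theorem exists_abs_kernelTerm_le (ha : 0 < a) (k : ℝ) {t : ℝ} (ht : 0 < t) :
    ∃ C, 0 ≤ C ∧ ∀ x y n, |kernelTerm a k t x y (n + 1)| ≤ C * expRatio a t ^ n := by
  refine ⟨(1 + |k|) ^ 3 * |(eigNorm a k true)⁻¹| + (1 + |k|) ^ 3 * |(eigNorm a k false)⁻¹|,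
    by positivity, fun x y n => ?_⟩
  rw [kernelTerm_eq, add_mul]
  exact (abs_add_le _ _).trans
    (add_le_add (abs_eigKernel_le ha ht x y (n, true)) (abs_eigKernel_le ha ht x y (n, false)))

theorem summable_expRatio_pow (ha : 0 < a) {t : ℝ} (ht : 0 < t) :
    Summable fun n => expRatio a t ^ n :=
  summable_geometric_of_lt_one (Real.exp_pos _).le (expRatio_lt_one ha ht)

theorem summable_kernelTerm (ha : 0 < a) (k : ℝ) {t : ℝ} (ht : 0 < t) (x y : ℝ) :
    Summable fun n : ℕ => kernelTerm a k t x y (n + 1) := by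
  obtain ⟨C, -, hC⟩ := exists_abs_kernelTerm_le ha k ht
  exact Summable.of_norm_bounded ((summable_expRatio_pow ha ht).mul_left C) fun n => hC x y n

theorem measurable_eigKernel (t x : ℝ) (i : ℕ × Bool) :
    Measurable fun y => eigKernel a k t x y i :=
  (measurable_A k).mul ((((measurable_eig a k i).const_mul _).mul_const _).mul_const _)

theorem measurable_kernelTerm (t x : ℝ) (n : ℕ) :
    Measurable fun y => kernelTerm a k t x y (n + 1) := by
  simp only [kernelTerm_eq]
  exact (measurable_eigKernel t x _).add (measurable_eigKernel t x _)

theorem integrable_mul_kernelTerm (ha : 0 < a) (u₀ : L2I a) {t : ℝ} (ht : 0 < t) (x : ℝ) (n : ℕ) :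
    IntegrableOn (fun y => u₀ y * kernelTerm a k t x y (n + 1)) (Ioo (-a) a) := by
  obtain ⟨C, -, hC⟩ := exists_abs_kernelTerm_le ha k ht
  exact ((Lp.memLp u₀).integrable one_le_two).mul_bdd
    (measurable_kernelTerm t x n).aestronglyMeasurable (Eventually.of_forall fun y => hC x y n)

theorem integrable_mul_eigKernel (ha : 0 < a) (u₀ : L2I a) {t : ℝ} (ht : 0 < t) (x : ℝ)
    (i : ℕ × Bool) : IntegrableOn (fun y => u₀ y * eigKernel a k t x y i) (Ioo (-a) a) :=
  ((Lp.memLp u₀).integrable one_le_two).mul_bdd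
    (measurable_eigKernel t x i).aestronglyMeasurable
    (Eventually.of_forall fun y => abs_eigKernel_le ha ht x y i)

theorem integral_mul_eigKernel (u₀ : L2I a) (t x : ℝ) (i : ℕ × Bool) :
    ∫ y in Ioo (-a) a, u₀ y * eigKernel a k t x y i =
      coef a k u₀ i * Real.exp (-(freq a i) ^ 2 * t / 2) * eig a k i x := by
  have e : ∀ y, u₀ y * eigKernel a k t x y i = (eigNorm a k i.2)⁻¹ * eig a k i x *
      Real.exp (-(freq a i) ^ 2 * t / 2) * (A k y * u₀ y * eig a k i y) := fun y => by
    rw [eigKernel]; ring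
  simp only [e]
  rw [integral_const_mul, ← inner_A_eigL_eq_integral, coef]
  ring

theorem integral_mul_kernelTerm (ha : 0 < a) (u₀ : L2I a) {t : ℝ} (ht : 0 < t) (x : ℝ) (n : ℕ) :
    ∫ y in Ioo (-a) a, u₀ y * kernelTerm a k t x y (n + 1) = termPt a k u₀ t x (n + 1) := by
  simp only [kernelTerm_eq, mul_add]
  rw [integral_add (integrable_mul_eigKernel ha u₀ ht x _) (integrable_mul_eigKernel ha u₀ ht x _),
    integral_mul_eigKernel, integral_mul_eigKernel, termPt_eq ha]

theorem integrableOn_mul_pbar (ha : 0 < a) (u₀ : L2I a) {t : ℝ} (ht : 0 < t) (x : ℝ) :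
    IntegrableOn (fun y => u₀ y * pbar a k t x y) (Ioo (-a) a) := by
  obtain ⟨C, -, hC⟩ := exists_abs_kernelTerm_le ha k ht
  have hm : Measurable fun y => pbar a k t x y := by
    refine measurable_of_tendsto_metrizable
      (f := fun N y => ∑ n ∈ Finset.range N, kernelTerm a k t x y (n + 1))
      (fun N => Finset.measurable_fun_sum _ fun n _ => measurable_kernelTerm t x n) ?_
    exact tendsto_pi_nhds.2 fun y => (summable_kernelTerm ha k ht x y).hasSum.tendsto_sum_nat
  refine ((Lp.memLp u₀).integrable one_le_two).mul_bdd (c := ∑' n, C * expRatio a t ^ n)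
    hm.aestronglyMeasurable (Eventually.of_forall fun y => ?_)
  exact tsum_of_norm_bounded ((summable_expRatio_pow ha ht).mul_left C).hasSum fun n => hC x y n

/-- The kernel bound is uniform in `y` and `u₀` is integrable on the bounded interval, so the
integrals of the norms form a summable series and sum and integral may be exchanged. -/
theorem hasSum_termPt (ha : 0 < a) (u₀ : L2I a) {t : ℝ} (ht : 0 < t) (x : ℝ) :
    HasSum (fun n : ℕ => termPt a k u₀ t x (n + 1))
      (∫ y in Ioo (-a) a, u₀ y * pbar a k t x y) := by
  obtain ⟨C, hC0, hC⟩ := exists_abs_kernelTerm_le ha k ht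
  have hu : IntegrableOn u₀ (Ioo (-a) a) := (Lp.memLp u₀).integrable one_le_two
  have h := hasSum_integral_of_summable_integral_norm
    (fun n => integrable_mul_kernelTerm (k := k) ha u₀ ht x n) (by
      refine Summable.of_nonneg_of_le (fun n => integral_nonneg fun y => norm_nonneg _)
        (fun n => ?_) (((summable_expRatio_pow ha ht).mul_left C).mul_left
          (∫ y in Ioo (-a) a, ‖u₀ y‖))
      rw [← integral_mul_const]
      refine integral_mono (integrable_mul_kernelTerm (k := k) ha u₀ ht x n).norm
        (hu.norm.mul_const _) fun y => ?_
      simp only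
      rw [norm_mul]
      exact mul_le_mul_of_nonneg_left (hC x y n) (norm_nonneg _))
  simp only [integral_mul_kernelTerm ha u₀ ht, tsum_mul_left] at h
  exact h

theorem coeFn_termL (u₀ : L2I a) (t : ℝ) (n : ℕ) :
    termL a k u₀ t n =ᵐ[muI a] fun x => termPt a k u₀ t x n := by
  have hf : fL a n =ᵐ[muI a] f a n := (memLp_f a n).coeFn_toLp
  have hg : gL a k n =ᵐ[muI a] g a k n := (memLp_g a k n).coeFn_toLp
  unfold termL
  set p := coeffA a k u₀ n * Real.exp (-(lam a n) ^ 2 * t / 2)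
  set q := coeffB a k u₀ n * Real.exp (-(mu a n) ^ 2 * t / 2)
  filter_upwards [hf, hg, Lp.coeFn_add (p • fL a n) (q • gL a k n), Lp.coeFn_smul p (fL a n),
    Lp.coeFn_smul q (gL a k n)] with x h1 h2 h3 h4 h5
  rw [h3, Pi.add_apply, h4, h5, Pi.smul_apply, Pi.smul_apply, h1, h2]
  rfl

theorem coeFn_sum_termL (u₀ : L2I a) (t : ℝ) (N : ℕ) :
    (∑ n ∈ Finset.range N, termL a k u₀ t (n + 1) : L2I a) =ᵐ[muI a]
      fun x => ∑ n ∈ Finset.range N, termPt a k u₀ t x (n + 1) := by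
  induction N with
  | zero =>
    simp only [Finset.range_zero, Finset.sum_empty]
    exact Lp.coeFn_zero ℝ 2 (muI a)
  | succ N ih =>
    simp only [Finset.sum_range_succ]
    filter_upwards [ih, coeFn_termL (k := k) u₀ t (N + 1),
      Lp.coeFn_add (∑ n ∈ Finset.range N, termL a k u₀ t (n + 1)) (termL a k u₀ t (N + 1))]
      with x h1 h2 h3
    rw [h3, Pi.add_apply, h1, h2]

/-- Convergence in `L²` gives almost everywhere convergence along a subsequence of partial sums,
whose pointwise limit is already known from `hasSum_termPt`. -/
theorem ae_spectralSol_eq (ha : 0 < a) (u₀ : L2I a) {t : ℝ} (ht : 0 < t) :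
    ∀ᵐ x ∂(muI a), spectralSol a k u₀ t x = ∫ y in Ioo (-a) a, u₀ y * pbar a k t x y := by
  have h : Tendsto (fun N => ∑ n ∈ Finset.range N, termL a k u₀ t (n + 1)) atTop
      (𝓝 (spectralSol a k u₀ t)) := by
    rw [spectralSol_eq_sol ha u₀ ht.le]
    exact (hasSum_termL ha u₀ ht.le).tendsto_sum_nat
  obtain ⟨φ, hφ, hlim⟩ := (tendstoInMeasure_of_tendsto_Lp h).exists_seq_tendsto_ae
  filter_upwards [hlim, ae_all_iff.2 fun N => coeFn_sum_termL (k := k) u₀ t N] with x h1 h2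
  simp only [h2] at h1
  exact tendsto_nhds_unique h1
    ((hasSum_termPt ha u₀ ht x).tendsto_sum_nat.comp hφ.tendsto_atTop)

end Pointwise

end SignChanging

end

theorem mainTheorem5 (a k : ℝ) (ha : 0 < a) (hk0 : k ≠ 0) (hk1 : k ≠ -1) (u₀ : L2I a) :
    (∀ t : ℝ, 0 ≤ t →
      HasSum (fun n : ℕ => termL a k u₀ t (n + 1)) (spectralSol a k u₀ t)) ∧
    IsWeakSolution a k u₀ (spectralSol a k u₀) ∧
    ContinuousOn (spectralSol a k u₀) (Ici 0) ∧
    (∀ v : ℝ → L2I a, IsWeakSolution a k u₀ v →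
      ∀ t : ℝ, 0 ≤ t → v t = spectralSol a k u₀ t) ∧
    (∀ t : ℝ, 0 < t →
      (∀ x ∈ Ioo (-a) a,
        (∀ y ∈ Ioo (-a) a, Summable (fun n : ℕ => kernelTerm a k t x y (n + 1))) ∧
        IntegrableOn (fun y => u₀ y * pbar a k t x y) (Ioo (-a) a) ∧
        HasSum (fun n : ℕ => termPt a k u₀ t x (n + 1))
          (∫ y in Ioo (-a) a, u₀ y * pbar a k t x y)) ∧
      ∀ᵐ x ∂(muI a),
        spectralSol a k u₀ t x = ∫ y in Ioo (-a) a, u₀ y * pbar a k t x y) := by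
  refine ⟨fun t ht => ?_, ?_, ?_, fun v hv t ht => ?_,
    fun t ht => ⟨fun x _ => ⟨fun y _ => ?_, ?_, ?_⟩, ?_⟩⟩
  · rw [spectralSol_eq_sol ha u₀ ht]
    exact hasSum_termL ha u₀ ht
  · exact isWeakSolution_of_eqOn_sol ha hk0 hk1 fun t ht => spectralSol_eq_sol ha u₀ ht
  · exact (continuousOn_sol ha u₀).congr fun t ht => spectralSol_eq_sol ha u₀ ht
  · rw [hv.eq_sol ha hk0 hk1 ht, spectralSol_eq_sol ha u₀ ht]
  · exact summable_kernelTerm ha k ht x y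
  · exact integrableOn_mul_pbar ha u₀ ht x
  · exact hasSum_termPt ha u₀ ht x
  · exact ae_spectralSol_eq ha u₀ ht
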